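/- Let $p\ge 1$, let $a_1,\dots,a_{p-1}>0$ and $a>0$, and put $a_0=a_p=0$. For $\lambda>0$ consider the (tuned) Fused Lasso penalty on $\mathbb{R}^p$ $$f_\lambda(\beta)=\lambda\|A\beta\|_1=\lambda\sum_{i=1}^{p-1}a_i|\beta_{i+1}-\beta_i|+\lambda\sum_{i=1}^{p}a|\beta_i| ,$$ where $A$ is the $(2p-1)\times p$ matrix with rows $\beta\mapsto a_i(\beta_{i+1}-\beta_i)$, $1\le i\le p-1$, and $\beta\mapsto a\beta_j$, $1\le j\le p$. The pattern of $\beta$ is $$I_A(\beta)=\operatorname*{argmax}_{s\in\{\pm1\}^{2p-1}}\langle \lambda A^Ts,\beta\rangle ,$$ the set of all maximizing sign vectors (so $I_A(\beta)=I_A(\beta')$ if and only if $\operatorname{sgn}(A\beta)=\operatorname{sgn}(A\beta')$). Let $X_1,X_2,\dots$ be i.i.d. centered random vectors in $\mathbb{R}^p$ with finite second moments and covariance matrix $C=\mathbb{I}$, let $\varepsilon_1,\varepsilon_2,\dots$ be i.i.d. centered real random variables with variance $\sigma^2\in(0,\infty)$, and let the sequences $(X_i)$ and $(\varepsilon_i)$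 be independent. For $\beta^0\in\mathbb{R}^p$, $\lambda>0$ and $n\in\mathbb{N}$, put $y_i=\langle X_i,\beta^0\rangle+\varepsilon_i$ and let $\hat\beta_n=\hat\beta_n(\beta^0,\lambda)$ be a random vector that almost surely minimizes $$\beta\mapsto\tfrac12\sum_{i=1}^n\big(y_i-\langle X_i,\beta\rangle\big)^2+\sqrt n\,f_\lambda(\beta)$$ over $\mathbb{R}^p$. Then for every $\beta^0\in\mathbb{R}^p$ and every $\lambda>0$ the limit $\lim_{n\to\infty}\mathbb{P}[I_A(\hat\beta_n)=I_A(\beta^0)]$ exists, and the Fused Lasso asymptotically recovers all its patterns, i.e. $$\forall\,\beta^0\in\mathbb{R}^p:\qquad \lim_{n\to\infty}\mathbb{P}\big[I_A(\hat\beta_n)=I_A(\beta^0)\big]\ \xrightarrow[\lambda\to\infty]{}\ 1 ,$$ if and only if the following two conditions hold: 1. the sequence $(0,a_1,\dots,a_{p-1},0)$ is strictly concave, i.e. there is a strictly concave function $F:\mathbb{R}\to\mathbb{R}$ with $F(i)=a_i$ for $i=0,1,\dots,p$; 2. $a>\max\{a_i+a_{i+1}:0\le i\le p-1\}$. -/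

import Mathlib

open MeasureTheory ProbabilityTheory Filter Topology
open scoped Matrix

noncomputable section

/-- The pattern at `x` of the polyhedral gauge `x ↦ max_{s ∈ S} ⟪v s, x⟫`: the set of all indices
at which the maximum is attained. -/
def pattern {S E : Type*} [NormedAddCommGroup E] [InnerProductSpace ℝ E] (v : S → E) (x : E) :
    Set S :=
  {s | ∀ t, inner ℝ (v t) x ≤ inner ℝ (v s) x}

/-- The generalized Lasso penalty `x ↦ lam * ‖A x‖₁`. -/
def genLasso {ι : Type*} [Fintype ι] {p : ℕ} (A : Matrix ι (Fin p) ℝ) (lam : ℝ)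
    (x : EuclideanSpace ℝ (Fin p)) : ℝ :=
  lam * ∑ r, |A.mulVec x r|

/-- The vectors `Aᵀ S (lam, …, lam)ᵀ`, with `S` running through the diagonal sign matrices (coded by
`s : ι → {1, -1}`), whose support function is the generalized Lasso penalty; see
`isGreatest_genLasso`. -/
def genLassoVertex {ι : Type*} [Fintype ι] {p : ℕ} (A : Matrix ι (Fin p) ℝ) (lam : ℝ)
    (s : ι → ℤˣ) : EuclideanSpace ℝ (Fin p) :=
  WithLp.toLp 2 (A.transpose.mulVec fun r => ((s r : ℤ) : ℝ) * lam)

/-- The pattern `I_A(x)` of the generalized Lasso: the set of all sign vectors `s` that maximize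
`⟪Aᵀ S (lam, …, lam)ᵀ, x⟫`. -/
def genLassoPattern {ι : Type*} [Fintype ι] {p : ℕ} (A : Matrix ι (Fin p) ℝ) (lam : ℝ)
    (x : EuclideanSpace ℝ (Fin p)) : Set (ι → ℤˣ) :=
  pattern (genLassoVertex A lam) x

theorem inner_genLassoVertex {ι : Type*} [Fintype ι] {p : ℕ} (A : Matrix ι (Fin p) ℝ) (lam : ℝ)
    (s : ι → ℤˣ) (x : EuclideanSpace ℝ (Fin p)) :
    inner ℝ (genLassoVertex A lam s) x = lam * ∑ r, ((s r : ℤ) : ℝ) * A.mulVec x r := by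
  have h : inner ℝ (genLassoVertex A lam s) x
      = dotProduct x.ofLp (A.transpose.mulVec fun r => ((s r : ℤ) : ℝ) * lam) := by
    simp [genLassoVertex, EuclideanSpace.inner_eq_star_dotProduct]
  rw [h, Matrix.dotProduct_mulVec, Matrix.vecMul_transpose, dotProduct, Finset.mul_sum]
  exact Finset.sum_congr rfl fun r _ => by ring

/-- The generalized Lasso penalty is the maximum of the linear forms given by its vertices. -/
theorem isGreatest_genLasso {ι : Type*} [Fintype ι] {p : ℕ} (A : Matrix ι (Fin p) ℝ) {lam : ℝ}
    (hlam : 0 ≤ lam) (x : EuclideanSpace ℝ (Fin p)) :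
    IsGreatest (Set.range fun s => inner ℝ (genLassoVertex A lam s) x) (genLasso A lam x) := by
  constructor
  · refine ⟨fun r => if 0 ≤ A.mulVec x r then 1 else -1, ?_⟩
    simp only [inner_genLassoVertex, genLasso]
    congr 1
    refine Finset.sum_congr rfl fun r _ => ?_
    by_cases h : 0 ≤ A.mulVec x r
    · simp [h, abs_of_nonneg h]
    · simp [h, abs_of_neg (not_le.mp h)]
  · rintro _ ⟨s, rfl⟩
    simp only [inner_genLassoVertex, genLasso]
    refine mul_le_mul_of_nonneg_left (Finset.sum_le_sum fun r _ => ?_) hlam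
    rcases Int.units_eq_one_or (s r) with h | h
    · simp [h, le_abs_self]
    · simp [h, neg_le_abs]

/-- The matrix of the tuned Fused Lasso on `ℝ^p`, with clustering weights `a 1, …, a (p - 1)` and
sparsity weight `κ`. The coordinates `β_1, …, β_p` are indexed by `Fin p`, from `0` on. The row
`Sum.inl i` of `A β` is `a (i + 1) * (β_{i+2} - β_{i+1})`, and the row `Sum.inr j` is
`κ * β_{j+1}`. -/
def fusedLassoMatrix (p : ℕ) (a : ℕ → ℝ) (κ : ℝ) : Matrix (Fin (p - 1) ⊕ Fin p) (Fin p) ℝ :=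
  Matrix.of fun r => match r with
    | Sum.inl i => a (i + 1) •
        (Pi.single (⟨i + 1, by omega⟩ : Fin p) 1 - Pi.single (⟨i, by omega⟩ : Fin p) 1)
    | Sum.inr j => κ • Pi.single j 1

/-- The tuned Fused Lasso penalty. -/
def fusedLasso (p : ℕ) (a : ℕ → ℝ) (κ lam : ℝ) (β : EuclideanSpace ℝ (Fin p)) : ℝ :=
  genLasso (fusedLassoMatrix p a κ) lam β

/-- The tuned Fused Lasso penalty, written out. -/
theorem fusedLasso_eq (p : ℕ) {a : ℕ → ℝ} (ha : ∀ i, 0 < i → i < p → 0 < a i) {κ : ℝ}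
    (hκ : 0 < κ) (lam : ℝ) (β : EuclideanSpace ℝ (Fin p)) :
    fusedLasso p a κ lam β =
      lam * ∑ i : Fin (p - 1), a (i + 1) * |β ⟨i + 1, by omega⟩ - β ⟨i, by omega⟩|
        + lam * ∑ j, κ * |β j| := by
  rw [fusedLasso, genLasso, Fintype.sum_sum_type, mul_add]
  congr 2
  · refine Finset.sum_congr rfl fun i _ => ?_
    change |(a (i + 1) • (Pi.single (⟨i + 1, by omega⟩ : Fin p) (1 : ℝ)
      - Pi.single (⟨i, by omega⟩ : Fin p) 1)) ⬝ᵥ β.ofLp| = _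
    rw [smul_dotProduct, sub_dotProduct, single_one_dotProduct, single_one_dotProduct, smul_eq_mul,
      abs_mul, abs_of_pos (ha (i + 1) (by omega) (by omega))]
  · refine Finset.sum_congr rfl fun j _ => ?_
    change |(κ • Pi.single j (1 : ℝ)) ⬝ᵥ β.ofLp| = _
    rw [smul_dotProduct, single_one_dotProduct, smul_eq_mul, abs_mul, abs_of_pos hκ]

/-- The random design and noise of the linear model: `X 0, X 1, …` are i.i.d. centered random
vectors with finite second moments and covariance matrix `C`, the noise variables `ε 0, ε 1, …` are
i.i.d. and centered with variance `σ ^ 2`, and the two sequences are independent. -/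
structure IsDesignAndNoise {Ω : Type*} [MeasurableSpace Ω] (μ : Measure Ω) {p : ℕ}
    (C : Matrix (Fin p) (Fin p) ℝ) (σ : ℝ) (X : ℕ → Ω → EuclideanSpace ℝ (Fin p))
    (ε : ℕ → Ω → ℝ) : Prop where
  iIndepFun_X : iIndepFun X μ
  identDistrib_X : ∀ i, IdentDistrib (X i) (X 0) μ μ
  memLp_X : MemLp (X 0) 2 μ
  integral_X : ∫ ω, X 0 ω ∂μ = 0
  covariance_X : ∀ j k, cov[fun ω => X 0 ω j, fun ω => X 0 ω k; μ] = C j k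
  iIndepFun_ε : iIndepFun ε μ
  identDistrib_ε : ∀ i, IdentDistrib (ε i) (ε 0) μ μ
  memLp_ε : MemLp (ε 0) 2 μ
  integral_ε : ∫ ω, ε 0 ω ∂μ = 0
  variance_ε : Var[ε 0; μ] = σ ^ 2
  indepFun : IndepFun (fun ω i => X i ω) (fun ω i => ε i ω) μ

/-- The responses of the linear model with coefficient vector `β₀`. -/
def response {Ω : Type*} {p : ℕ} (X : ℕ → Ω → EuclideanSpace ℝ (Fin p)) (ε : ℕ → Ω → ℝ)
    (β₀ : EuclideanSpace ℝ (Fin p)) (i : ℕ) (ω : Ω) : ℝ :=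
  inner ℝ (X i ω) β₀ + ε i ω

/-- The penalized least squares objective `‖y - X β‖² / 2 + √n f(β)` for the first `n`
observations. -/
def objective {p : ℕ} (f : EuclideanSpace ℝ (Fin p) → ℝ) (n : ℕ)
    (x : ℕ → EuclideanSpace ℝ (Fin p)) (y : ℕ → ℝ) (β : EuclideanSpace ℝ (Fin p)) : ℝ :=
  1 / 2 * ∑ i ∈ Finset.range n, (y i - inner ℝ (x i) β) ^ 2 + √n * f β

/-- `βhat` is a penalized least squares estimator, with penalty `√n f`, from the first `n`
observations: a random vector that almost surely minimizes the objective. -/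
def IsEstimator {Ω : Type*} [MeasurableSpace Ω] (μ : Measure Ω) {p : ℕ}
    (X : ℕ → Ω → EuclideanSpace ℝ (Fin p)) (Y : ℕ → Ω → ℝ)
    (f : EuclideanSpace ℝ (Fin p) → ℝ) (n : ℕ) (βhat : Ω → EuclideanSpace ℝ (Fin p)) : Prop :=
  AEMeasurable βhat μ ∧
    ∀ᵐ ω ∂μ, ∀ β, objective f n (fun i => X i ω) (fun i => Y i ω) (βhat ω) ≤
      objective f n (fun i => X i ω) (fun i => Y i ω) β

/-- The finite sequence `(a 0, …, a p)` is strictly concave: it is interpolated by a strictly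
concave function on the real line. -/
def StrictConcaveSeq (p : ℕ) (a : ℕ → ℝ) : Prop :=
  ∃ F : ℝ → ℝ, StrictConcaveOn ℝ Set.univ F ∧ ∀ i ≤ p, a i = F i

end

/-!
Write `φ r` for the rows of the penalty matrix `A`, `U` for the model space of `β₀` (all `u` with
`φ r u = 0` whenever `φ r β₀ = 0`), and `D` for the directional derivative of `‖A ·‖₁` at `β₀`,
`D h = ∑ r, absSlope (φ r β₀) (φ r h)`. Patterns are the sign vectors of `A β`
(`genLassoPattern_eq_iff`).

*Limits of the recovery probabilities.* In the coordinate `u = √n (β - β₀)` the objective becomes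
`½ ⟪Cₙ u, u⟫ - ⟪Wₙ, u⟫` plus the penalty, where the empirical second moment `Cₙ` tends to the
identity by the strong law of large numbers and the score `Wₙ = n^{-1/2} ∑ εᵢ Xᵢ` tends in
distribution to `N(0, σ² I)` by the central limit theorem. If `Cₙ` were the identity, the minimizer
would lie in `U`, which for large `n` means recovery of the pattern, exactly when
`⟪Wₙ, h⟫ ≤ lam * D h` for all `h ∈ Uᗮ`. For `Cₙ` close to the identity the same holds up to an error
`η ‖h‖` in this inequality: first order optimality gives one direction
(`mem_dualBody_of_sign_eq`), comparison of a minimizer with its projection to `U` the other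
(`sign_eq_of_mem_dualBody`). The set of admissible `w` is convex, so its frontier is a Gaussian null
set, and the sandwich closes (`tendsto_measureReal_of_dualBody_sandwich`): the recovery probability
tends to the Gaussian measure of `{w | ∀ h ∈ Uᗮ, ⟪w, h⟫ ≤ lam * D h}`.

*Large penalties.* As `lam → ∞` these sets exhaust the space if `D > 0` on `Uᗮ ∖ {0}`, and otherwise
miss a fixed open half-space (`tendsto_measureReal_dualBody_iff`).

*The Fused Lasso.* It remains to decide when `D > 0` on `Uᗮ ∖ {0}` for every `β₀`. Summation by parts
turns numbers `t i`, one for each edge between neighbouring coefficients, with `t i = ± a i` at the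
jumps of `β₀`, `|t i| < a i` elsewhere, and constant increments along the blocks of equal
coefficients, into a certificate of positivity (`l1Slope_fusedLassoMatrix_pos`). Linear interpolation
between the jumps provides them when `a` is strictly concave
(`StrictConcaveSeq.exists_interpolation`). Conversely, monotone coefficients with a single tie test
strict concavity, and a single zero between larger coefficients tests the bound on `κ`
(`second_diff_of_l1Slope_pos`, `add_lt_of_l1Slope_pos`).
-/

/-! ### One-sided derivatives of sums of absolute values -/

/-- The one-sided directional derivative of the absolute value at `x` in the direction `h`. -/
noncomputable def absSlope (x h : ℝ) : ℝ :=
  if x = 0 then |h| else (SignType.sign x : ℝ) * h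

theorem absSlope_zero_left (h : ℝ) : absSlope 0 h = |h| := if_pos rfl

theorem absSlope_of_pos {x : ℝ} (hx : 0 < x) (h : ℝ) : absSlope x h = h := by
  simp [absSlope, hx.ne', sign_pos hx]

theorem absSlope_of_neg {x : ℝ} (hx : x < 0) (h : ℝ) : absSlope x h = -h := by
  simp [absSlope, hx.ne, sign_neg hx]

theorem absSlope_congr {x y : ℝ} (hxy : SignType.sign x = SignType.sign y) (h : ℝ) :
    absSlope x h = absSlope y h := by
  have : x = 0 ↔ y = 0 := by rw [← sign_eq_zero_iff, hxy, sign_eq_zero_iff]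
  simp [absSlope, hxy, this]

theorem abs_absSlope_le (x h : ℝ) : |absSlope x h| ≤ |h| := by
  rcases lt_trichotomy x 0 with hx | rfl | hx
  · simp [absSlope_of_neg hx]
  · simp [absSlope_zero_left]
  · simp [absSlope_of_pos hx]

theorem absSlope_mul {t : ℝ} (ht : 0 ≤ t) (x h : ℝ) : absSlope x (t * h) = t * absSlope x h := by
  rcases lt_trichotomy x 0 with hx | rfl | hx
  · simp [absSlope_of_neg hx]
  · simp [absSlope_zero_left, abs_mul, abs_of_nonneg ht]
  · simp [absSlope_of_pos hx]

theorem absSlope_mul_mul {c : ℝ} (hc : 0 < c) (x h : ℝ) :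
    absSlope (c * x) (c * h) = c * absSlope x h := by
  rw [absSlope_mul hc.le, absSlope_congr (y := x)]
  rw [sign_mul, sign_pos hc, one_mul]

theorem absSlope_add {x h₁ : ℝ} (hx : x = 0 → h₁ = 0) (h₂ : ℝ) :
    absSlope x (h₁ + h₂) = absSlope x h₁ + absSlope x h₂ := by
  rcases lt_trichotomy x 0 with h | rfl | h
  · simp [absSlope_of_neg h, add_comm]
  · simp [absSlope_zero_left, hx]
  · simp [absSlope_of_pos h]

theorem abs_add_absSlope_le (x h : ℝ) : |x| + absSlope x h ≤ |x + h| := by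
  rcases lt_trichotomy x 0 with hx | rfl | hx
  · rw [absSlope_of_neg hx, abs_of_neg hx]; linarith [neg_le_abs (x + h)]
  · simp [absSlope_zero_left]
  · rw [absSlope_of_pos hx, abs_of_pos hx]; exact le_abs_self _

/-- The absolute value is affine along directions that do not cross zero. -/
theorem abs_add_eq_absSlope {x h : ℝ} (hx : x ≠ 0 → |h| ≤ |x|) :
    |x + h| = |x| + absSlope x h := by
  rcases lt_trichotomy x 0 with h0 | rfl | h0
  · have := hx h0.ne
    rw [abs_of_neg h0] at this
    rw [absSlope_of_neg h0, abs_of_neg h0, abs_of_nonpos (by linarith [le_abs_self h])]; ring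
  · simp [absSlope_zero_left]
  · have := hx h0.ne'
    rw [abs_of_pos h0] at this
    rw [absSlope_of_pos h0, abs_of_pos h0, abs_of_nonneg (by linarith [neg_le_abs h])]

section Slope

variable {E ι : Type*} [NormedAddCommGroup E] [InnerProductSpace ℝ E] [Fintype ι]

/-- The one-sided directional derivative of `x ↦ ∑ r, |φ r x|` at `x` in the direction `h`. -/
noncomputable def l1Slope (φ : ι → E →L[ℝ] ℝ) (x h : E) : ℝ :=
  ∑ r, absSlope (φ r x) (φ r h)

/-- The directions in which every form `φ r` that vanishes at `x` keeps vanishing: the linear span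
of the points that share their signs `sign (φ r ·)` with `x`. -/
def modelSpace (φ : ι → E →L[ℝ] ℝ) (x : E) : Submodule ℝ E :=
  ⨅ r : {r // φ r x = 0}, LinearMap.ker (φ r : E →ₗ[ℝ] ℝ)

omit [Fintype ι] in
theorem mem_modelSpace {φ : ι → E →L[ℝ] ℝ} {x u : E} :
    u ∈ modelSpace φ x ↔ ∀ r, φ r x = 0 → φ r u = 0 := by
  simp [modelSpace]

theorem l1Slope_congr {φ : ι → E →L[ℝ] ℝ} {x y : E}
    (hxy : ∀ r, SignType.sign (φ r x) = SignType.sign (φ r y)) (h : E) :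
    l1Slope φ x h = l1Slope φ y h :=
  Finset.sum_congr rfl fun r _ => absSlope_congr (hxy r) _

theorem abs_l1Slope_le (φ : ι → E →L[ℝ] ℝ) (x h : E) :
    |l1Slope φ x h| ≤ (∑ r, ‖φ r‖) * ‖h‖ := by
  rw [Finset.sum_mul]
  refine (Finset.abs_sum_le_sum_abs _ _).trans (Finset.sum_le_sum fun r _ => ?_)
  exact (abs_absSlope_le _ _).trans ((φ r).le_opNorm h)

theorem continuous_l1Slope (φ : ι → E →L[ℝ] ℝ) (x : E) : Continuous (l1Slope φ x) := by
  refine continuous_finsetSum _ fun r _ => ?_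
  unfold absSlope
  split_ifs <;> fun_prop

theorem l1Slope_smul (φ : ι → E →L[ℝ] ℝ) (x h : E) {t : ℝ} (ht : 0 ≤ t) :
    l1Slope φ x (t • h) = t * l1Slope φ x h := by
  simp [l1Slope, absSlope_mul ht, Finset.mul_sum]

theorem l1Slope_add (φ : ι → E →L[ℝ] ℝ) {x u : E} (hu : u ∈ modelSpace φ x) (h : E) :
    l1Slope φ x (u + h) = l1Slope φ x u + l1Slope φ x h := by
  rw [l1Slope, l1Slope, l1Slope, ← Finset.sum_add_distrib]
  refine Finset.sum_congr rfl fun r _ => ?_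
  rw [map_add, absSlope_add (mem_modelSpace.1 hu r)]

theorem sum_abs_add_l1Slope_le (φ : ι → E →L[ℝ] ℝ) (x h : E) :
    ∑ r, |φ r x| + l1Slope φ x h ≤ ∑ r, |φ r (x + h)| := by
  rw [l1Slope, ← Finset.sum_add_distrib]
  refine Finset.sum_le_sum fun r _ => ?_
  rw [map_add]; exact abs_add_absSlope_le _ _

theorem sum_abs_add_eq_l1Slope (φ : ι → E →L[ℝ] ℝ) {x h : E}
    (hxh : ∀ r, φ r x ≠ 0 → |φ r h| ≤ |φ r x|) :
    ∑ r, |φ r (x + h)| = ∑ r, |φ r x| + l1Slope φ x h := by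
  rw [l1Slope, ← Finset.sum_add_distrib]
  refine Finset.sum_congr rfl fun r _ => ?_
  rw [map_add]; exact abs_add_eq_absSlope (hxh r)

/-! ### Sign recovery for perturbed quadratic objectives -/

/-- The `w` whose pairing with every `h ∈ U` is at most `D h + η ‖h‖`. If `D` is the directional
derivative of a penalty and `U` the orthogonal complement of its model space, this is for `η = 0`
the sum of the subdifferential and the model space; `η` enlarges or shrinks it. -/
def dualBody (U : Submodule ℝ E) (D : E → ℝ) (η : ℝ) : Set E :=
  {w | ∀ h ∈ U, inner ℝ w h ≤ D h + η * ‖h‖}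

omit [Fintype ι] in
theorem convex_dualBody (U : Submodule ℝ E) (D : E → ℝ) (η : ℝ) : Convex ℝ (dualBody U D η) := by
  have : dualBody U D η = ⋂ h ∈ U, {w | innerₗ E h w ≤ D h + η * ‖h‖} := by
    ext w; simp [dualBody, real_inner_comm]
  rw [this]
  exact convex_iInter₂ fun h _ => convex_halfSpace_le (innerₗ E h).isLinear _

omit [Fintype ι] in
theorem isClosed_dualBody (U : Submodule ℝ E) (D : E → ℝ) (η : ℝ) :
    IsClosed (dualBody U D η) := by
  have : dualBody U D η = ⋂ h ∈ U, {w | inner ℝ w h ≤ D h + η * ‖h‖} := by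
    ext w; simp [dualBody]
  rw [this]
  exact isClosed_biInter fun h _ => isClosed_le (by fun_prop) continuous_const

omit [Fintype ι] in
theorem dualBody_mono (U : Submodule ℝ E) (D : E → ℝ) {η η' : ℝ} (h : η ≤ η') :
    dualBody U D η ⊆ dualBody U D η' := fun w hw v hv =>
  (hw v hv).trans (by gcongr)

variable (φ : ι → E →L[ℝ] ℝ) (lam : ℝ) (B : E →ₗ[ℝ] E →ₗ[ℝ] ℝ) (W x : E)

/-- The quadratic function with Hessian `B` and gradient `-W` at `0`, plus the `ℓ¹` penalty
`lam * ∑ r, |φ r (x + u)|`. -/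
noncomputable def localObjective (u : E) : ℝ :=
  1 / 2 * B u u - inner ℝ W u + lam * ∑ r, |φ r (x + u)|

variable {φ lam B W x} {δ R : ℝ} {u : E}

theorem le_of_abs_bilin_sub_inner_le (hB : ∀ u v, |B u v - inner ℝ u v| ≤ δ * ‖u‖ * ‖v‖)
    (v : E) : (1 - δ) * ‖v‖ ^ 2 ≤ B v v := by
  have := (abs_le.1 (hB v v)).1
  rw [real_inner_self_eq_norm_sq] at this
  linarith

theorem norm_le_of_isMin_localObjective (hlam : 0 ≤ lam)
    (hB : ∀ u v, |B u v - inner ℝ u v| ≤ δ * ‖u‖ * ‖v‖) (hδ : δ ≤ 1 / 2) (hW : ‖W‖ ≤ R)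
    (hu : ∀ v, localObjective φ lam B W x u ≤ localObjective φ lam B W x v) :
    ‖u‖ ≤ 4 * (R + lam * ∑ r, ‖φ r‖) := by
  have h0 := hu 0
  have h1 := mul_le_mul_of_nonneg_left (sum_abs_add_l1Slope_le φ x u) hlam
  have h2 := mul_le_mul_of_nonneg_left (abs_le.1 (abs_l1Slope_le φ x u)).1 hlam
  have h3 := le_of_abs_bilin_sub_inner_le hB u
  have h4 : inner ℝ W u ≤ R * ‖u‖ := (real_inner_le_norm W u).trans (by gcongr)
  simp only [localObjective, map_zero, inner_zero_right, add_zero, mul_zero, zero_add, sub_zero]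
    at h0
  by_contra! hlt
  have hpos : 0 ≤ 4 * (R + lam * ∑ r, ‖φ r‖) := by
    have := (norm_nonneg W).trans hW
    positivity
  have h5 : 0 < ‖u‖ := hpos.trans_lt hlt
  have h6 := mul_lt_mul_of_pos_right hlt h5
  nlinarith

/-- First order optimality: a minimizer that has the signs of `x` puts `W` into the slightly
enlarged dual body. -/
theorem mem_dualBody_of_sign_eq (hlam : 0 ≤ lam) (hBs : ∀ u v, B u v = B v u)
    (hB : ∀ u v, |B u v - inner ℝ u v| ≤ δ * ‖u‖ * ‖v‖) (hδ0 : 0 ≤ δ) (hδ : δ ≤ 1 / 2)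
    (hW : ‖W‖ ≤ R)
    (hu : ∀ v, localObjective φ lam B W x u ≤ localObjective φ lam B W x v)
    (hsign : ∀ r, SignType.sign (φ r (x + u)) = SignType.sign (φ r x)) :
    W ∈ dualBody (modelSpace φ x)ᗮ (fun h => lam * l1Slope φ x h)
      (δ * (4 * (R + lam * ∑ r, ‖φ r‖))) := by
  intro h hh
  have hnorm := norm_le_of_isMin_localObjective hlam hB hδ hW hu
  have hmem : u ∈ modelSpace φ x := mem_modelSpace.2 fun r hr => by
    have := hsign r
    rw [map_add, hr, zero_add, sign_zero, sign_eq_zero_iff] at this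
    exact this
  have horth : inner ℝ u h = (0 : ℝ) := Submodule.inner_right_of_mem_orthogonal hmem hh
  -- Along `u + t • h` the penalty is affine for all small `t ≥ 0`.
  have hsmall : ∀ᶠ t : ℝ in 𝓝[>] 0, ∀ r, φ r (x + u) ≠ 0 → |φ r (t • h)| ≤ |φ r (x + u)| := by
    rw [eventually_all]
    intro r
    by_cases hr : φ r (x + u) = 0
    · simp [hr]
    · have : Tendsto (fun t : ℝ => |φ r (t • h)|) (𝓝[>] 0) (𝓝 0) := by
        have hc : Continuous fun t : ℝ => |φ r (t • h)| := by fun_prop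
        have := hc.tendsto 0
        simp only [zero_smul, map_zero, abs_zero] at this
        exact this.mono_left nhdsWithin_le_nhds
      filter_upwards [this.eventually_lt_const (abs_pos.2 hr)] with t ht _ using ht.le
  have hineq : ∀ᶠ t : ℝ in 𝓝[>] 0,
      0 ≤ t / 2 * B h h + (B u h - inner ℝ W h + lam * l1Slope φ x h) := by
    filter_upwards [hsmall, self_mem_nhdsWithin] with t ht (ht0 : 0 < t)
    have h1 := hu (u + t • h)
    have h2 := sum_abs_add_eq_l1Slope φ ht
    rw [l1Slope_congr hsign, l1Slope_smul _ _ _ ht0.le] at h2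
    rw [localObjective, localObjective, ← add_assoc, h2] at h1
    simp only [map_add, map_smul, LinearMap.add_apply, LinearMap.smul_apply, smul_eq_mul,
      inner_add_right, real_inner_smul_right, hBs h u] at h1
    have h3 : 0 ≤ t * (t / 2 * B h h + (B u h - inner ℝ W h + lam * l1Slope φ x h)) := by
      nlinarith
    exact nonneg_of_mul_nonneg_right h3 ht0
  have hlim : Tendsto (fun t : ℝ => t / 2 * B h h + (B u h - inner ℝ W h + lam * l1Slope φ x h))
      (𝓝[>] 0) (𝓝 (B u h - inner ℝ W h + lam * l1Slope φ x h)) := by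
    have hc : Continuous fun t : ℝ =>
      t / 2 * B h h + (B u h - inner ℝ W h + lam * l1Slope φ x h) := by fun_prop
    have := hc.tendsto 0
    simp only [zero_div, zero_mul, zero_add] at this
    exact this.mono_left nhdsWithin_le_nhds
  have h1 := ge_of_tendsto hlim hineq
  have h2 := (abs_le.1 (hB u h)).2
  rw [horth] at h2
  have h3 : δ * ‖u‖ * ‖h‖ ≤ δ * (4 * (R + lam * ∑ r, ‖φ r‖)) * ‖h‖ := by gcongr
  change inner ℝ W h ≤ lam * l1Slope φ x h + _
  linarith

/-- If `W` lies in the slightly shrunk dual body, then replacing a minimizer by its projection to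
the model space would improve it, so the minimizer lies in the model space and, `x` being far from
every hyperplane `φ r = 0` that does not contain it, has the signs of `x`. -/
theorem sign_eq_of_mem_dualBody [FiniteDimensional ℝ E] (hlam : 0 ≤ lam)
    (hBs : ∀ u v, B u v = B v u)
    (hB : ∀ u v, |B u v - inner ℝ u v| ≤ δ * ‖u‖ * ‖v‖) (hδ0 : 0 ≤ δ) (hδ : δ ≤ 1 / 2)
    (hW : ‖W‖ ≤ R)
    (hu : ∀ v, localObjective φ lam B W x u ≤ localObjective φ lam B W x v)
    (hfar : ∀ r, φ r x ≠ 0 → ‖φ r‖ * (4 * (R + lam * ∑ r, ‖φ r‖)) < |φ r x|)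
    (hmem : W ∈ dualBody (modelSpace φ x)ᗮ (fun h => lam * l1Slope φ x h)
      (-(δ * (4 * (R + lam * ∑ r, ‖φ r‖))))) (r : ι) :
    SignType.sign (φ r (x + u)) = SignType.sign (φ r x) := by
  set ρ := 4 * (R + lam * ∑ r, ‖φ r‖) with hρ
  have hnorm : ‖u‖ ≤ ρ := norm_le_of_isMin_localObjective hlam hB hδ hW hu
  set U := modelSpace φ x with hU
  set u₁ : E := U.starProjection u with hu₁
  set u₂ : E := u - u₁ with hu₂
  have hu₁U : u₁ ∈ U := U.starProjection_apply_mem u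
  have hu₂U : u₂ ∈ Uᗮ := U.sub_starProjection_mem_orthogonal u
  have hsum : u = u₁ + u₂ := by rw [hu₂]; abel
  have hnorm₁ : ‖u₁‖ ≤ ρ := (U.norm_starProjection_apply_le u).trans hnorm
  have hφ : ∀ v : E, ‖v‖ ≤ ρ → ∀ r, φ r x ≠ 0 → |φ r v| < |φ r x| := fun v hv r hr =>
    (((φ r).le_opNorm v).trans (by gcongr)).trans_lt (hfar r hr)
  have h1 := hu u₁
  have h2 := mul_le_mul_of_nonneg_left (sum_abs_add_l1Slope_le φ x u) hlam
  have h3 := sum_abs_add_eq_l1Slope φ fun r hr => (hφ u₁ hnorm₁ r hr).le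
  have h4 : l1Slope φ x u = l1Slope φ x u₁ + l1Slope φ x u₂ := by
    rw [hsum]; exact l1Slope_add φ hu₁U u₂
  rw [localObjective, localObjective, h3] at h1
  have h5 : B u u = B u₁ u₁ + 2 * B u₁ u₂ + B u₂ u₂ := by
    rw [hsum]; simp only [map_add, LinearMap.add_apply, hBs u₂ u₁]; ring
  have h6 : inner ℝ W u = inner ℝ W u₁ + (inner ℝ W u₂ : ℝ) := by
    rw [hsum, inner_add_right]
  have h7 := (abs_le.1 (hB u₁ u₂)).1
  rw [Submodule.inner_right_of_mem_orthogonal hu₁U hu₂U] at h7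
  have h8 := le_of_abs_bilin_sub_inner_le hB u₂
  have h9 : inner ℝ W u₂ ≤ lam * l1Slope φ x u₂ + -(δ * ρ) * ‖u₂‖ := hmem u₂ hu₂U
  have h10 : δ * ‖u₁‖ * ‖u₂‖ ≤ δ * ρ * ‖u₂‖ := by gcongr
  have h11 : u₂ = 0 := by
    rw [← norm_eq_zero, ← sq_eq_zero_iff]
    nlinarith [sq_nonneg ‖u₂‖]
  have huU : u ∈ U := by rw [hsum, h11, add_zero]; exact hu₁U
  by_cases hr : φ r x = 0
  · rw [map_add, hr, mem_modelSpace.1 huU r hr, add_zero]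
  · have := abs_lt.1 (hφ u hnorm r hr)
    rw [map_add]
    rcases lt_or_gt_of_ne hr with hlt | hgt
    · rw [abs_of_neg hlt] at this
      rw [sign_neg hlt, sign_neg (by linarith)]
    · rw [abs_of_pos hgt] at this
      rw [sign_pos hgt, sign_pos (by linarith)]

end Slope

/-! ### The Gaussian limit law -/

namespace MeasureTheory.Measure

theorem AbsolutelyContinuous.pi_fin {α : Type*} [MeasurableSpace α] {μ ν : Measure α}
    [SigmaFinite μ] [SigmaFinite ν] (h : μ ≪ ν) (n : ℕ) :
    Measure.pi (fun _ : Fin n => μ) ≪ Measure.pi (fun _ : Fin n => ν) := by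
  induction n with
  | zero => rw [Measure.pi_of_empty, Measure.pi_of_empty]
  | succ n ih =>
    rw [← (measurePreserving_piFinSuccAbove (fun _ : Fin (n + 1) => μ) 0).symm.map_eq,
      ← (measurePreserving_piFinSuccAbove (fun _ : Fin (n + 1) => ν) 0).symm.map_eq]
    exact (h.prod ih).map (MeasurableEquiv.measurable _)

end MeasureTheory.Measure

/-- The centered normal distribution on `ℝ^p` with covariance matrix `σ ^ 2` times the identity. -/
noncomputable def isotropicGaussian (p : ℕ) (σ : ℝ) : Measure (EuclideanSpace ℝ (Fin p)) :=
  (stdGaussian (EuclideanSpace ℝ (Fin p))).map (σ • ·)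

instance (p : ℕ) (σ : ℝ) : IsProbabilityMeasure (isotropicGaussian p σ) :=
  Measure.isProbabilityMeasure_map (by fun_prop)

theorem charFun_isotropicGaussian (p : ℕ) (σ : ℝ) (t : EuclideanSpace ℝ (Fin p)) :
    charFun (isotropicGaussian p σ) t = Complex.exp (-(σ ^ 2 * ‖t‖ ^ 2) / 2) := by
  rw [isotropicGaussian, charFun_map_smul, charFun_stdGaussian, norm_smul, Real.norm_eq_abs]
  push_cast
  rw [mul_pow, ← Complex.ofReal_pow |σ|, sq_abs, Complex.ofReal_pow]

theorem isotropicGaussian_absolutelyContinuous (p : ℕ) {σ : ℝ} (hσ : σ ≠ 0) :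
    isotropicGaussian p σ ≪ volume := by
  have h1 : stdGaussian (EuclideanSpace ℝ (Fin p)) ≪ volume := by
    rw [← map_pi_eq_stdGaussian, ← (PiLp.volume_preserving_toLp (Fin p)).map_eq]
    exact ((gaussianReal_absolutelyContinuous 0 one_ne_zero).pi_fin p).map (by fun_prop)
  refine Measure.AbsolutelyContinuous.mk fun s hs h0 => ?_
  rw [isotropicGaussian, Measure.map_apply (by fun_prop) hs]
  exact h1 (by rw [Measure.addHaar_preimage_smul _ hσ, h0, mul_zero])

theorem absolutelyContinuous_isotropicGaussian (p : ℕ) {σ : ℝ} (hσ : σ ≠ 0) :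
    volume ≪ isotropicGaussian p σ := by
  have h1 : volume ≪ stdGaussian (EuclideanSpace ℝ (Fin p)) := by
    rw [← map_pi_eq_stdGaussian, ← (PiLp.volume_preserving_toLp (Fin p)).map_eq]
    exact ((gaussianReal_absolutelyContinuous' 0 one_ne_zero).pi_fin p).map (by fun_prop)
  refine Measure.AbsolutelyContinuous.mk fun s hs h0 => ?_
  rw [isotropicGaussian, Measure.map_apply (by fun_prop) hs] at h0
  have h2 := h1 h0
  rw [Measure.addHaar_preimage_smul _ hσ, mul_eq_zero] at h2
  refine h2.resolve_left ?_
  simp [hσ]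

/-! ### The multivariate central limit theorem -/

section Independence

variable {Ω : Type*} [MeasurableSpace Ω] {μ : Measure Ω}

theorem iIndepFun.prodMk_of_measurable {α β : Type*} [MeasurableSpace α] [MeasurableSpace β]
    {X : ℕ → Ω → α} {Y : ℕ → Ω → β} (mX : ∀ i, Measurable (X i)) (mY : ∀ i, Measurable (Y i))
    (hX : iIndepFun X μ) (hY : iIndepFun Y μ)
    (hXY : IndepFun (fun ω i => X i ω) (fun ω i => Y i ω) μ) :
    iIndepFun (fun i ω => (X i ω, Y i ω)) μ := by
  rw [iIndepFun_iff_iIndep]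
  refine iIndepSets.iIndep (fun i => ((mX i).prodMk (mY i)).comap_le)
    (fun i => (fun s => (fun ω => (X i ω, Y i ω)) ⁻¹' s) ''
      Set.image2 (· ×ˢ ·) {s | MeasurableSet s} {t | MeasurableSet t})
    (fun i => ?_) (fun i => ?_) ?_
  · exact isPiSystem_prod.comap _
  · rw [← MeasurableSpace.comap_generateFrom, generateFrom_prod]
  rw [iIndepSets_iff]
  intro S f hf
  have hf' : ∀ i, ∃ A : Set α, ∃ B : Set β, MeasurableSet A ∧ MeasurableSet B ∧
      (i ∈ S → f i = X i ⁻¹' A ∩ Y i ⁻¹' B) := by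
    intro i
    by_cases hi : i ∈ S
    · obtain ⟨_, ⟨A, hA, B, hB, rfl⟩, hAB⟩ := hf i hi
      exact ⟨A, B, hA, hB, fun _ => hAB.symm⟩
    · exact ⟨∅, ∅, .empty, .empty, fun h => absurd h hi⟩
  choose A B hA hB hAB using hf'
  have key : ∀ T : Finset ℕ, μ ((⋂ i ∈ T, X i ⁻¹' A i) ∩ ⋂ i ∈ T, Y i ⁻¹' B i) =
      μ (⋂ i ∈ T, X i ⁻¹' A i) * μ (⋂ i ∈ T, Y i ⁻¹' B i) := by
    intro T
    have := hXY.measure_inter_preimage_eq_mul (⋂ i ∈ T, {x | x i ∈ A i}) (⋂ i ∈ T, {x | x i ∈ B i})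
      (Finset.measurableSet_biInter _ fun i _ => measurable_pi_apply i (hA i))
      (Finset.measurableSet_biInter _ fun i _ => measurable_pi_apply i (hB i))
    simp only [Set.preimage_iInter] at this
    exact this
  have hX' := hX.meas_biInter (S := S) (s := fun i => X i ⁻¹' A i) fun i _ => ⟨A i, hA i, rfl⟩
  have hY' := hY.meas_biInter (S := S) (s := fun i => Y i ⁻¹' B i) fun i _ => ⟨B i, hB i, rfl⟩
  have h1 : ⋂ i ∈ S, f i = (⋂ i ∈ S, X i ⁻¹' A i) ∩ ⋂ i ∈ S, Y i ⁻¹' B i := by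
    simp_rw [← Set.iInter_inter_distrib]
    exact Set.iInter₂_congr fun i hi => hAB i hi
  rw [h1, key, hX', hY', ← Finset.prod_mul_distrib]
  refine Finset.prod_congr rfl fun i hi => ?_
  have := key {i}
  simp only [Finset.mem_singleton, Set.iInter_iInter_eq_left] at this
  rw [hAB i hi, this]

/-- Independent sequences of independent random variables form a sequence of independent pairs. -/
theorem iIndepFun.prodMk_of_indepFun {α β : Type*} [MeasurableSpace α] [MeasurableSpace β]
    {X : ℕ → Ω → α} {Y : ℕ → Ω → β} (mX : ∀ i, AEMeasurable (X i) μ)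
    (mY : ∀ i, AEMeasurable (Y i) μ) (hX : iIndepFun X μ) (hY : iIndepFun Y μ)
    (hXY : IndepFun (fun ω i => X i ω) (fun ω i => Y i ω) μ) :
    iIndepFun (fun i ω => (X i ω, Y i ω)) μ := by
  have eX : ∀ᵐ ω ∂μ, ∀ i, X i ω = (mX i).mk _ ω := ae_all_iff.2 fun i => (mX i).ae_eq_mk
  have eY : ∀ᵐ ω ∂μ, ∀ i, Y i ω = (mY i).mk _ ω := ae_all_iff.2 fun i => (mY i).ae_eq_mk
  have h := iIndepFun.prodMk_of_measurable (fun i => (mX i).measurable_mk)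
    (fun i => (mY i).measurable_mk) (hX.congr fun i => (mX i).ae_eq_mk)
    (hY.congr fun i => (mY i).ae_eq_mk)
    (hXY.congr (eX.mono fun ω h => funext h) (eY.mono fun ω h => funext h))
  refine h.congr fun i => ?_
  filter_upwards [eX, eY] with ω h1 h2
  rw [h1, h2]

/-- A multivariate central limit theorem: the normalized sums of i.i.d. centered random vectors
with covariance matrix `σ ^ 2` times the identity converge in distribution to
`isotropicGaussian p σ`. -/
theorem tendstoInDistribution_isotropicGaussian [IsProbabilityMeasure μ] {p : ℕ} {σ : ℝ}
    {Y : ℕ → Ω → EuclideanSpace ℝ (Fin p)} (hindep : iIndepFun Y μ)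
    (hident : ∀ i, IdentDistrib (Y i) (Y 0) μ μ) (hL2 : MemLp (Y 0) 2 μ)
    (hmean : ∀ t, ∫ ω, inner ℝ (Y 0 ω) t ∂μ = 0)
    (hvar : ∀ t, ∫ ω, (inner ℝ (Y 0 ω) t) ^ 2 ∂μ = σ ^ 2 * ‖t‖ ^ 2) :
    TendstoInDistribution (fun (n : ℕ) ω => (√n)⁻¹ • ∑ k ∈ Finset.range n, Y k ω) atTop id
      (fun _ => μ) (isotropicGaussian p σ) where
  forall_aemeasurable n :=
    (Finset.aemeasurable_fun_sum (Finset.range n) fun i _ =>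
      (hident i).aemeasurable_fst).fun_const_smul _
  aemeasurable_limit := aemeasurable_id
  tendsto := by
    refine ProbabilityMeasure.tendsto_iff_tendsto_charFun.2 fun t => ?_
    have mY i := (hident i).aemeasurable_fst
    have mt : Measurable fun y : EuclideanSpace ℝ (Fin p) => (inner ℝ y t : ℝ) := by fun_prop
    have hL2t : MemLp (fun ω => (inner ℝ (Y 0 ω) t : ℝ)) 2 μ := by
      simpa only [real_inner_comm] using hL2.const_inner (𝕜 := ℝ) t
    have hV : Var[fun ω => (inner ℝ (Y 0 ω) t : ℝ); μ] = σ ^ 2 * ‖t‖ ^ 2 := by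
      rw [variance_of_integral_eq_zero hL2t.aestronglyMeasurable.aemeasurable (hmean t)]
      exact hvar t
    have hclt := (tendstoInDistribution_inv_sqrt_mul_sum_sub
      (X := fun i ω => (inner ℝ (Y i ω) t : ℝ))
      (HasLaw.id (μ := gaussianReal 0 Var[fun ω => (inner ℝ (Y 0 ω) t : ℝ); μ].toNNReal)) hL2t
      (hindep.comp (fun _ y => (inner ℝ y t : ℝ)) fun _ => mt)
      (fun i => (hident i).comp mt)).tendsto
    have h := ProbabilityMeasure.tendsto_iff_tendsto_charFun.1 hclt 1
    simp only [ProbabilityMeasure.coe_mk, Measure.map_id, charFun_gaussianReal] at h ⊢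
    rw [charFun_isotropicGaussian]
    convert! h using 2 with n
    · rw [charFun_apply, charFun_apply, integral_map, integral_map]
      · simp [hmean, real_inner_smul_left, sum_inner]
      · exact ((Finset.aemeasurable_fun_sum _ fun k _ =>
          mt.comp_aemeasurable (mY k)).sub_const _).const_mul _
      · fun_prop
      · exact (Finset.aemeasurable_fun_sum (Finset.range n) fun k _ => mY k).fun_const_smul _
      · fun_prop
    · rw [hV, Real.coe_toNNReal _ (by positivity)]
      congr 1
      push_cast
      ring

end Independence

/-! ### Limits of the recovery probabilities -/

section Sandwich

variable {E : Type*} [NormedAddCommGroup E] [InnerProductSpace ℝ E] [FiniteDimensional ℝ E]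
  [MeasurableSpace E] [BorelSpace E]

theorem measure_frontier_dualBody {ν : Measure E} (hν : ν ≪ volume) (U : Submodule ℝ E)
    (D : E → ℝ) (η : ℝ) : ν (frontier (dualBody U D η)) = 0 :=
  hν ((convex_dualBody U D η).addHaar_frontier volume)

/-- The measure of `dualBody U D η` is continuous at `η = 0`: since the frontier of the convex set
`dualBody U D 0` is null, it is enough that the sets decrease to `dualBody U D 0` as `η ↓ 0` and
exhaust its interior as `η ↑ 0`. -/
theorem exists_measure_dualBody_close {ν : Measure E} [IsProbabilityMeasure ν] (hν : ν ≪ volume)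
    (U : Submodule ℝ E) (D : E → ℝ) {e : ℝ} (he : 0 < e) :
    ∃ η > 0, ν.real (dualBody U D η) < ν.real (dualBody U D 0) + e ∧
      ν.real (dualBody U D 0) - e < ν.real (dualBody U D (-η)) := by
  set s : ℕ → ℝ := fun k => 1 / ((k : ℝ) + 1) with hs
  have s0 : ∀ k, 0 < s k := fun k => Nat.one_div_pos_of_nat
  have santi : Antitone s := fun i j hij => Nat.one_div_le_one_div hij
  have slim : Tendsto s atTop (𝓝 0) := tendsto_one_div_add_atTop_nhds_zero_nat
  have hupper : ⋂ k, dualBody U D (s k) = dualBody U D 0 := by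
    ext w
    simp only [Set.mem_iInter]
    refine ⟨fun h v hv => ?_, fun h k => dualBody_mono U D (s0 k).le h⟩
    have hlim : Tendsto (fun k => D v + s k * ‖v‖) atTop (𝓝 (D v + 0 * ‖v‖)) :=
      tendsto_const_nhds.add (slim.mul_const _)
    exact ge_of_tendsto' hlim fun k => h k v hv
  have hlower : interior (dualBody U D 0) ⊆ ⋃ k, dualBody U D (-s k) := by
    intro w hw
    obtain ⟨r, hr, hball⟩ := Metric.isOpen_iff.1 isOpen_interior w hw
    obtain ⟨k, hk⟩ := (slim.eventually_lt_const hr).exists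
    refine Set.mem_iUnion.2 ⟨k, fun v hv => ?_⟩
    rcases eq_or_ne v 0 with rfl | hv0
    · simpa using interior_subset hw 0 U.zero_mem
    have hn : ‖v‖ ≠ 0 := norm_ne_zero_iff.2 hv0
    have hmem : w + (s k / ‖v‖) • v ∈ Metric.ball w r := by
      rw [mem_ball_iff_norm, add_sub_cancel_left, norm_smul, Real.norm_of_nonneg
        (div_nonneg (s0 k).le (norm_nonneg v)), div_mul_cancel₀ _ hn]
      exact hk
    have := interior_subset (hball hmem) v hv
    rw [inner_add_left, real_inner_smul_left, real_inner_self_eq_norm_sq, zero_mul, add_zero] at this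
    have h2 : s k / ‖v‖ * ‖v‖ ^ 2 = s k * ‖v‖ := by field_simp
    linarith
  have hU : Tendsto (fun k => ν.real (dualBody U D (s k))) atTop (𝓝 (ν.real (dualBody U D 0))) := by
    have h := tendsto_measure_iInter_atTop (μ := ν) (s := fun k => dualBody U D (s k))
      (fun k => (isClosed_dualBody U D _).measurableSet.nullMeasurableSet)
      (fun i j hij => dualBody_mono U D (santi hij)) ⟨0, measure_ne_top _ _⟩
    rw [hupper] at h
    exact (ENNReal.tendsto_toReal (measure_ne_top _ _)).comp h
  have hL : Tendsto (fun k => ν.real (dualBody U D (-s k))) atTop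
      (𝓝 (ν.real (⋃ k, dualBody U D (-s k)))) := by
    have h := tendsto_measure_iUnion_atTop (μ := ν) (s := fun k => dualBody U D (-s k))
      (fun i j hij => dualBody_mono U D (neg_le_neg (santi hij)))
    exact (ENNReal.tendsto_toReal (measure_ne_top _ _)).comp h
  have hint : ν.real (dualBody U D 0) ≤ ν.real (⋃ k, dualBody U D (-s k)) := by
    have h1 : ν (dualBody U D 0) ≤ ν (interior (dualBody U D 0)) := by
      have := measure_frontier_dualBody hν U D 0
      rw [(isClosed_dualBody U D 0).frontier_eq] at this
      exact measure_mono_ae (ae_le_set.2 this)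
    exact ENNReal.toReal_mono (measure_ne_top _ _) (h1.trans (measure_mono hlower))
  have e1 := hU.eventually_lt_const (lt_add_of_pos_right _ he)
  have e2 := hL.eventually_const_lt (lt_of_lt_of_le (sub_lt_self _ he) hint)
  obtain ⟨k, h1, h2⟩ := (e1.and e2).exists
  exact ⟨s k, s0 k, h1, h2⟩

/-- If, up to small probability, the event `S n` contains `W n ∈ dualBody U D (-η)` and is contained
in `W n ∈ dualBody U D η`, and `W n` converges in distribution to an absolutely continuous law,
then the probability of `S n` converges to the limit law of `dualBody U D 0`. -/
theorem tendsto_measureReal_of_dualBody_sandwich {Ω : Type*} [MeasurableSpace Ω] {μ : Measure Ω}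
    [IsProbabilityMeasure μ] {ν : Measure E} [IsProbabilityMeasure ν] (hν : ν ≪ volume)
    {W : ℕ → Ω → E} (hW : TendstoInDistribution W atTop id (fun _ => μ) ν) {Δ : ℕ → Ω → ℝ}
    (hΔ : TendstoInMeasure μ Δ atTop (fun _ => 0)) (U : Submodule ℝ E) (D : E → ℝ)
    {S : ℕ → Set Ω}
    (hS : ∀ η > 0, ∀ R, ∃ δ > 0, ∀ᶠ n in atTop, ∀ᵐ ω ∂μ, ‖Δ n ω‖ < δ → ‖W n ω‖ ≤ R →
      (ω ∈ S n → W n ω ∈ dualBody U D η) ∧ (W n ω ∈ dualBody U D (-η) → ω ∈ S n)) :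
    Tendsto (fun n => μ.real (S n)) atTop (𝓝 (ν.real (dualBody U D 0))) := by
  have hport : ∀ K : Set E, MeasurableSet K → ν (frontier K) = 0 →
      Tendsto (fun n => μ.real (W n ⁻¹' K)) atTop (𝓝 (ν.real K)) := by
    intro K hK hfr
    have h := ProbabilityMeasure.tendsto_measure_of_null_frontier_of_tendsto' hW.tendsto (E := K)
      (by simpa using hfr)
    simp only [ProbabilityMeasure.coe_mk, Measure.map_id] at h
    refine ((ENNReal.tendsto_toReal (measure_ne_top _ _)).comp h).congr fun n => ?_
    simp [Measure.real, Measure.map_apply_of_aemeasurable (hW.forall_aemeasurable n) hK]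
  rw [Metric.tendsto_atTop]
  intro e he
  have he5 : 0 < e / 5 := by positivity
  obtain ⟨η, hη, hup, hlow⟩ := exists_measure_dualBody_close hν U D he5
  obtain ⟨R, hR⟩ : ∃ R : ℕ, ν.real (Metric.closedBall 0 R)ᶜ < e / 5 := by
    have h := tendsto_measure_iInter_atTop (μ := ν)
      (s := fun k : ℕ => (Metric.closedBall (0 : E) k)ᶜ)
      (fun k => Metric.isClosed_closedBall.measurableSet.compl.nullMeasurableSet)
      (fun i j hij => Set.compl_subset_compl.2
        (Metric.closedBall_subset_closedBall (by exact_mod_cast hij))) ⟨0, measure_ne_top _ _⟩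
    rw [← Set.compl_iUnion, Metric.iUnion_closedBall_nat, Set.compl_univ, measure_empty] at h
    have h' := (ENNReal.tendsto_toReal ENNReal.zero_ne_top).comp h
    exact (h'.eventually_lt_const (by simpa using he5)).exists
  obtain ⟨δ, hδ, hS⟩ := hS η hη R
  have eup := (hport _ (isClosed_dualBody U D η).measurableSet
    (measure_frontier_dualBody hν U D η)).eventually_lt_const (lt_add_of_pos_right _ he5)
  have elow := (hport _ (isClosed_dualBody U D (-η)).measurableSet
    (measure_frontier_dualBody hν U D (-η))).eventually_const_lt (sub_lt_self _ he5)
  have eball := (hport (Metric.closedBall 0 R)ᶜ Metric.isClosed_closedBall.measurableSet.compl (by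
    rw [frontier_compl]
    exact hν ((convex_closedBall 0 _).addHaar_frontier volume))).eventually_lt_const hR
  have eΔ : ∀ᶠ n in atTop, μ.real {ω | δ ≤ ‖Δ n ω‖} < e / 5 := by
    have h := (tendstoInMeasure_iff_norm.1 hΔ) δ hδ
    have h' := (ENNReal.tendsto_toReal ENNReal.zero_ne_top).comp h
    filter_upwards [h'.eventually_lt_const (u := e / 5) (by simpa using he5)] with n hn
    simpa [Measure.real] using hn
  obtain ⟨N, hN⟩ := eventually_atTop.1 (hS.and (eup.and (elow.and (eball.and eΔ))))
  refine ⟨N, fun n hn => ?_⟩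
  obtain ⟨hSn, hupn, hlown, hballn, hΔn⟩ := hN n hn
  have hmono : ∀ A B : Set Ω, (∀ᵐ ω ∂μ, ‖Δ n ω‖ < δ → ‖W n ω‖ ≤ R → ω ∈ A → ω ∈ B) →
      μ.real A ≤ μ.real B + (μ.real (W n ⁻¹' (Metric.closedBall 0 R)ᶜ) +
        μ.real {ω | δ ≤ ‖Δ n ω‖}) := by
    intro A B hAB
    have h1 : μ A ≤ μ (B ∪ (W n ⁻¹' (Metric.closedBall 0 R)ᶜ ∪ {ω | δ ≤ ‖Δ n ω‖})) := by
      refine measure_mono_ae ?_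
      filter_upwards [hAB] with ω h hA
      by_cases h1 : ‖Δ n ω‖ < δ
      · by_cases h2 : ‖W n ω‖ ≤ R
        · exact Or.inl (h h1 h2 hA)
        · exact Or.inr (Or.inl (by simpa using h2))
      · exact Or.inr (Or.inr (not_lt.1 h1))
    refine (ENNReal.toReal_mono (measure_ne_top _ _) h1).trans ?_
    refine (measureReal_union_le _ _).trans ?_
    gcongr
    exact measureReal_union_le _ _
  have h1 := hmono (S n) (W n ⁻¹' dualBody U D η) (hSn.mono fun ω h a b => (h a b).1)
  have h2 := hmono (W n ⁻¹' dualBody U D (-η)) (S n) (hSn.mono fun ω h a b => (h a b).2)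
  rw [Real.dist_eq, abs_lt]
  constructor <;> linarith

/-- If `D` is positive on `U ∖ {0}`, the bodies `dualBody U (lam * D) 0` exhaust the whole space
as `lam → ∞`; otherwise they all miss a common open half-space. -/
theorem tendsto_measureReal_dualBody_iff {ν : Measure E} [IsProbabilityMeasure ν]
    [ν.IsOpenPosMeasure] (U : Submodule ℝ E) {D : E → ℝ} (hDc : Continuous D)
    (hDs : ∀ (t : ℝ) h, 0 ≤ t → D (t • h) = t * D h) :
    Tendsto (fun lam : ℝ => ν.real (dualBody U (fun h => lam * D h) 0)) atTop (𝓝 1) ↔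
      ∀ h ∈ U, h ≠ 0 → 0 < D h := by
  constructor
  · intro hlim h hU h0
    by_contra! hD
    have hopen : IsOpen {w : E | 0 < (inner ℝ w h : ℝ)} :=
      isOpen_lt continuous_const (by fun_prop)
    have hpos : 0 < ν.real {w : E | 0 < (inner ℝ w h : ℝ)} := by
      refine ENNReal.toReal_pos (hopen.measure_ne_zero ν ⟨h, ?_⟩) (measure_ne_top _ _)
      exact real_inner_self_pos.2 h0
    have hle : ∀ᶠ lam : ℝ in atTop, ν.real (dualBody U (fun h => lam * D h) 0) ≤
        1 - ν.real {w : E | 0 < (inner ℝ w h : ℝ)} := by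
      filter_upwards [eventually_ge_atTop 0] with lam hlam
      rw [← probReal_compl_eq_one_sub hopen.measurableSet]
      refine measureReal_mono fun w hw => ?_
      have := hw h hU
      rw [zero_mul, add_zero] at this
      exact not_lt.2 (this.trans (mul_nonpos_of_nonneg_of_nonpos hlam hD))
    linarith [le_of_tendsto hlim hle]
  · intro hpos
    obtain ⟨c, hc, hcD⟩ : ∃ c > 0, ∀ h ∈ U, c * ‖h‖ ≤ D h := by
      have hcomp : IsCompact (Metric.sphere (0 : E) 1 ∩ U) :=
        (isCompact_sphere 0 1).inter_right U.closed_of_finiteDimensional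
      obtain ⟨c, hc, hcD⟩ : ∃ c > 0, ∀ h ∈ Metric.sphere (0 : E) 1 ∩ U, c ≤ D h := by
        rcases (Metric.sphere (0 : E) 1 ∩ (U : Set E)).eq_empty_or_nonempty with he | hne
        · exact ⟨1, one_pos, by simp [he]⟩
        · obtain ⟨h₀, hh₀, hmin⟩ := hcomp.exists_isMinOn hne hDc.continuousOn
          refine ⟨D h₀, hpos h₀ hh₀.2 ?_, fun h hh => hmin hh⟩
          rintro rfl
          simpa using hh₀.1
      refine ⟨c, hc, fun h hh => ?_⟩
      rcases eq_or_ne h 0 with rfl | h0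
      · have := hDs 0 0 le_rfl
        simp only [zero_smul, zero_mul] at this
        simp [this]
      · have hn : 0 < ‖h‖ := norm_pos_iff.2 h0
        have := hcD (‖h‖⁻¹ • h) ⟨by simp [norm_smul, hn.ne'], U.smul_mem _ hh⟩
        rw [hDs _ _ (inv_nonneg.2 hn.le), ← div_eq_inv_mul, le_div_iff₀ hn] at this
        exact this
    have hball : Tendsto (fun r : ℝ => ν.real (Metric.closedBall 0 r)) atTop (𝓝 1) := by
      have h := tendsto_measure_iUnion_atTop (μ := ν) (s := fun r : ℝ => Metric.closedBall (0 : E) r)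
        (fun i j hij => Metric.closedBall_subset_closedBall hij)
      have hu : ⋃ r : ℝ, Metric.closedBall (0 : E) r = Set.univ :=
        Set.eq_univ_of_forall fun x => Set.mem_iUnion.2 ⟨‖x‖, by simp⟩
      rw [hu, measure_univ] at h
      have h' := (ENNReal.tendsto_toReal ENNReal.one_ne_top).comp h
      rwa [ENNReal.toReal_one] at h'
    refine tendsto_of_tendsto_of_tendsto_of_le_of_le'
      (hball.comp (tendsto_id.const_mul_atTop hc)) tendsto_const_nhds ?_
      (Eventually.of_forall fun _ => measureReal_le_one)
    filter_upwards [eventually_ge_atTop 0] with lam hlam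
    refine measureReal_mono fun w hw h hh => ?_
    have hw' : ‖w‖ ≤ c * lam := by simpa using hw
    calc inner ℝ w h ≤ ‖w‖ * ‖h‖ := real_inner_le_norm w h
      _ ≤ c * lam * ‖h‖ := by gcongr
      _ = lam * (c * ‖h‖) := by ring
      _ ≤ lam * D h + 0 * ‖h‖ := by rw [zero_mul, add_zero]; gcongr; exact hcD h hh

end Sandwich

/-! ### Sign vectors and patterns of the generalized Lasso -/

section GenLasso

variable {ι : Type*} {p : ℕ}

/-- The rows of a matrix, as continuous linear forms on Euclidean space. -/
noncomputable def rowForm (A : Matrix ι (Fin p) ℝ) (r : ι) : EuclideanSpace ℝ (Fin p) →L[ℝ] ℝ :=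
  LinearMap.toContinuousLinearMap
    (LinearMap.proj r ∘ₗ A.mulVecLin ∘ₗ (WithLp.linearEquiv 2 ℝ (Fin p → ℝ)).toLinearMap)

theorem rowForm_apply (A : Matrix ι (Fin p) ℝ) (r : ι) (x : EuclideanSpace ℝ (Fin p)) :
    rowForm A r x = A.mulVec x r := rfl

variable [Fintype ι]

theorem mem_genLassoPattern_iff (A : Matrix ι (Fin p) ℝ) {lam : ℝ} (hlam : 0 < lam)
    (x : EuclideanSpace ℝ (Fin p)) (s : ι → ℤˣ) :
    s ∈ genLassoPattern A lam x ↔ ∀ r, ((s r : ℤ) : ℝ) * rowForm A r x = |rowForm A r x| := by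
  have hle : ∀ r, ((s r : ℤ) : ℝ) * rowForm A r x ≤ |rowForm A r x| := by
    intro r
    rcases Int.units_eq_one_or (s r) with h | h
    · simp [h, le_abs_self]
    · simp [h, neg_le_abs]
  obtain ⟨⟨s₀, hs₀⟩, hub⟩ := isGreatest_genLasso A hlam.le x
  have hmax : s ∈ genLassoPattern A lam x ↔ inner ℝ (genLassoVertex A lam s) x = genLasso A lam x :=
    ⟨fun h => le_antisymm (hub ⟨s, rfl⟩) (hs₀ ▸ h s₀), fun h t => h ▸ hub ⟨t, rfl⟩⟩
  rw [hmax, inner_genLassoVertex, genLasso, mul_right_inj' hlam.ne']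
  exact (Finset.sum_eq_sum_iff_of_le fun r _ => hle r).trans (by simp [rowForm_apply])

theorem exists_mem_genLassoPattern_iff (A : Matrix ι (Fin p) ℝ) {lam : ℝ} (hlam : 0 < lam)
    (x : EuclideanSpace ℝ (Fin p)) (r : ι) (e : ℤˣ) :
    (∃ s ∈ genLassoPattern A lam x, s r = e) ↔ 0 ≤ ((e : ℤ) : ℝ) * rowForm A r x := by
  classical
  simp only [mem_genLassoPattern_iff A hlam]
  constructor
  · rintro ⟨s, hs, rfl⟩
    rw [hs r]; exact abs_nonneg _
  · intro he
    refine ⟨Function.update (fun q => if 0 ≤ rowForm A q x then 1 else -1) r e, fun q => ?_, by simp⟩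
    rcases eq_or_ne q r with rfl | hq
    · rw [Function.update_self]
      rcases Int.units_eq_one_or e with rfl | rfl
      · simp only [Units.val_one, Int.cast_one, one_mul] at he ⊢
        rw [abs_of_nonneg he]
      · simp only [Units.val_neg, Units.val_one, Int.cast_neg, Int.cast_one, neg_one_mul,
          neg_nonneg] at he ⊢
        rw [abs_of_nonpos he]
    · rw [Function.update_of_ne hq]
      by_cases h : 0 ≤ rowForm A q x
      · simp [h, abs_of_nonneg h]
      · simp [h, abs_of_neg (not_le.1 h)]

/-- Two points have the same pattern if and only if the rows of `A` have the same signs there. -/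
theorem genLassoPattern_eq_iff (A : Matrix ι (Fin p) ℝ) {lam : ℝ} (hlam : 0 < lam)
    (x y : EuclideanSpace ℝ (Fin p)) :
    genLassoPattern A lam x = genLassoPattern A lam y ↔
      ∀ r, SignType.sign (rowForm A r x) = SignType.sign (rowForm A r y) := by
  constructor
  · intro h r
    have key : ∀ e : ℤˣ, 0 ≤ ((e : ℤ) : ℝ) * rowForm A r x ↔ 0 ≤ ((e : ℤ) : ℝ) * rowForm A r y := by
      intro e
      rw [← exists_mem_genLassoPattern_iff A hlam, ← exists_mem_genLassoPattern_iff A hlam, h]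
    have h1 := key 1
    have h2 := key (-1)
    simp only [Units.val_neg, Units.val_one, Int.cast_neg, Int.cast_one, neg_one_mul, one_mul,
      neg_nonneg] at h1 h2
    rcases lt_trichotomy (rowForm A r x) 0 with hx | hx | hx
    · rw [sign_neg hx, sign_neg (not_le.1 fun hy => hx.not_ge (h1.2 hy))]
    · rw [hx, le_antisymm (h2.1 hx.le) (h1.1 hx.ge)]
    · rw [sign_pos hx, sign_pos (not_le.1 fun hy => hx.not_ge (h2.2 hy))]
  · intro h
    ext s
    rw [mem_genLassoPattern_iff A hlam, mem_genLassoPattern_iff A hlam]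
    refine forall_congr' fun r => ?_
    have hr := h r
    generalize rowForm A r x = a at hr ⊢
    generalize rowForm A r y = b at hr ⊢
    rcases lt_trichotomy a 0 with ha | rfl | ha
    · rw [sign_neg ha, eq_comm, sign_eq_neg_one_iff] at hr
      rw [abs_of_neg ha, abs_of_neg hr, neg_eq_neg_one_mul, neg_eq_neg_one_mul b,
        mul_left_inj' ha.ne, mul_left_inj' hr.ne]
    · rw [sign_zero, eq_comm, sign_eq_zero_iff] at hr
      rw [hr]
    · rw [sign_pos ha, eq_comm, sign_eq_one_iff] at hr
      rw [abs_of_pos ha, abs_of_pos hr, mul_eq_right₀ ha.ne', mul_eq_right₀ hr.ne']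

end GenLasso

/-! ### The linear model in local coordinates -/

section Sample

variable {p : ℕ}

/-- The empirical second moment form `(u, v) ↦ (1 / n) ∑ i < n, ⟪x i, u⟫ ⟪x i, v⟫`. -/
noncomputable def sampleForm (x : ℕ → EuclideanSpace ℝ (Fin p)) (n : ℕ) :
    EuclideanSpace ℝ (Fin p) →ₗ[ℝ] EuclideanSpace ℝ (Fin p) →ₗ[ℝ] ℝ :=
  LinearMap.mk₂ ℝ (fun u v => (n : ℝ)⁻¹ * ∑ i ∈ Finset.range n, inner ℝ (x i) u * inner ℝ (x i) v)
    (fun u u' v => by simp only [inner_add_right, add_mul, Finset.sum_add_distrib, mul_add])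
    (fun c u v => by
      simp only [real_inner_smul_right, smul_eq_mul, Finset.mul_sum]
      exact Finset.sum_congr rfl fun i _ => by ring)
    (fun u v v' => by simp only [inner_add_right, mul_add, Finset.sum_add_distrib])
    (fun c u v => by
      simp only [real_inner_smul_right, smul_eq_mul, Finset.mul_sum]
      exact Finset.sum_congr rfl fun i _ => by ring)

theorem sampleForm_apply (x : ℕ → EuclideanSpace ℝ (Fin p)) (n : ℕ)
    (u v : EuclideanSpace ℝ (Fin p)) : sampleForm x n u v =
      (n : ℝ)⁻¹ * ∑ i ∈ Finset.range n, inner ℝ (x i) u * inner ℝ (x i) v := rfl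

theorem sampleForm_comm (x : ℕ → EuclideanSpace ℝ (Fin p)) (n : ℕ)
    (u v : EuclideanSpace ℝ (Fin p)) : sampleForm x n u v = sampleForm x n v u := by
  simp only [sampleForm_apply, mul_comm]

/-- The entrywise `ℓ¹` distance of the empirical second moment matrix to the identity. -/
noncomputable def sampleDeviation (x : ℕ → EuclideanSpace ℝ (Fin p)) (n : ℕ) : ℝ :=
  ∑ j, ∑ k, |(∑ i ∈ Finset.range n, x i j * x i k) / n - (1 : Matrix (Fin p) (Fin p) ℝ) j k|

theorem sampleDeviation_nonneg (x : ℕ → EuclideanSpace ℝ (Fin p)) (n : ℕ) :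
    0 ≤ sampleDeviation x n :=
  Finset.sum_nonneg fun _ _ => Finset.sum_nonneg fun _ _ => abs_nonneg _

theorem abs_sampleForm_sub_inner_le (x : ℕ → EuclideanSpace ℝ (Fin p)) (n : ℕ)
    (u v : EuclideanSpace ℝ (Fin p)) :
    |sampleForm x n u v - inner ℝ u v| ≤ sampleDeviation x n * ‖u‖ * ‖v‖ := by
  have h1 : sampleForm x n u v =
      ∑ j, ∑ k, (∑ i ∈ Finset.range n, x i j * x i k) / n * (u j * v k) := by
    simp only [sampleForm_apply, PiLp.inner_apply, RCLike.inner_apply, conj_trivial,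
      Finset.sum_mul_sum]
    rw [Finset.sum_comm, Finset.mul_sum]
    refine Finset.sum_congr rfl fun j _ => ?_
    rw [Finset.sum_comm, Finset.mul_sum]
    refine Finset.sum_congr rfl fun k _ => ?_
    rw [div_eq_inv_mul, mul_assoc, Finset.sum_mul]
    congr 1
    exact Finset.sum_congr rfl fun i _ => by ring
  have h2 : inner ℝ u v = ∑ j, ∑ k, (1 : Matrix (Fin p) (Fin p) ℝ) j k * (u j * v k) := by
    simp [PiLp.inner_apply, Matrix.one_apply, mul_comm]
  rw [h1, h2, ← Finset.sum_sub_distrib, sampleDeviation, Finset.sum_mul, Finset.sum_mul]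
  refine (Finset.abs_sum_le_sum_abs _ _).trans (Finset.sum_le_sum fun j _ => ?_)
  rw [← Finset.sum_sub_distrib, Finset.sum_mul, Finset.sum_mul]
  refine (Finset.abs_sum_le_sum_abs _ _).trans (Finset.sum_le_sum fun k _ => ?_)
  rw [← sub_mul, abs_mul, abs_mul, mul_assoc]
  gcongr
  · exact PiLp.norm_apply_le u j
  · exact PiLp.norm_apply_le v k

/-- In the local coordinate `u = √n (β - β₀)`, the objective of the penalized least squares problem
is, up to a constant, a `localObjective`. -/
theorem objective_eq_localObjective {ι : Type*} [Fintype ι] (A : Matrix ι (Fin p) ℝ) (lam : ℝ)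
    {n : ℕ} (hn : n ≠ 0) (x : ℕ → EuclideanSpace ℝ (Fin p)) (e : ℕ → ℝ)
    (β₀ u : EuclideanSpace ℝ (Fin p)) :
    objective (genLasso A lam) n x (fun i => inner ℝ (x i) β₀ + e i) (β₀ + (√n)⁻¹ • u) =
      1 / 2 * ∑ i ∈ Finset.range n, e i ^ 2 + localObjective (rowForm A) lam (sampleForm x n)
        ((√n)⁻¹ • ∑ i ∈ Finset.range n, e i • x i) (√n • β₀) u := by
  have hn' : 0 < √(n : ℝ) := Real.sqrt_pos.2 (by exact_mod_cast Nat.pos_of_ne_zero hn)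
  have h1 : √n * genLasso A lam (β₀ + (√n)⁻¹ • u) =
      lam * ∑ r, |rowForm A r (√n • β₀ + u)| := by
    rw [genLasso, mul_left_comm, Finset.mul_sum]
    congr 1
    refine Finset.sum_congr rfl fun r _ => ?_
    rw [← rowForm_apply, ← abs_of_pos hn', ← abs_mul, abs_of_pos hn', ← smul_eq_mul, ← map_smul,
      smul_add, smul_inv_smul₀ hn'.ne']
  have h2 : ∑ i ∈ Finset.range n, (inner ℝ (x i) β₀ + e i - inner ℝ (x i) (β₀ + (√n)⁻¹ • u)) ^ 2 =
      ∑ i ∈ Finset.range n, e i ^ 2 - 2 * ((√n)⁻¹ * ∑ i ∈ Finset.range n, e i * inner ℝ (x i) u) +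
        (n : ℝ)⁻¹ * ∑ i ∈ Finset.range n, inner ℝ (x i) u * inner ℝ (x i) u := by
    have h3 : (n : ℝ)⁻¹ = (√n)⁻¹ * (√n)⁻¹ := by
      rw [← mul_inv, Real.mul_self_sqrt (Nat.cast_nonneg n)]
    rw [h3]
    simp only [Finset.mul_sum, ← Finset.sum_sub_distrib, ← Finset.sum_add_distrib]
    refine Finset.sum_congr rfl fun i _ => ?_
    rw [inner_add_right, real_inner_smul_right]
    ring
  rw [objective, h1, h2, localObjective, sampleForm_apply, real_inner_smul_left, sum_inner]
  simp only [real_inner_smul_left]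
  ring

end Sample

/-! ### Asymptotics of the generalized Lasso -/

section Asymptotics

variable {Ω : Type*} [MeasurableSpace Ω] {μ : Measure Ω} [IsProbabilityMeasure μ] {p : ℕ} {σ : ℝ}
  {X : ℕ → Ω → EuclideanSpace ℝ (Fin p)} {ε : ℕ → Ω → ℝ}

namespace IsDesignAndNoise

theorem integral_coord {C : Matrix (Fin p) (Fin p) ℝ} (h : IsDesignAndNoise μ C σ X ε) (j : Fin p) :
    ∫ ω, X 0 ω j ∂μ = 0 := by
  have := (EuclideanSpace.proj (𝕜 := ℝ) j).integral_comp_comm (h.memLp_X.integrable one_le_two)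
  simpa [h.integral_X] using this

omit [IsProbabilityMeasure μ] in
theorem memLp_coord {C : Matrix (Fin p) (Fin p) ℝ} (h : IsDesignAndNoise μ C σ X ε) (j : Fin p) :
    MemLp (fun ω => X 0 ω j) 2 μ :=
  (EuclideanSpace.proj (𝕜 := ℝ) j).comp_memLp' h.memLp_X

theorem integral_coord_mul {C : Matrix (Fin p) (Fin p) ℝ} (h : IsDesignAndNoise μ C σ X ε)
    (j k : Fin p) : ∫ ω, X 0 ω j * X 0 ω k ∂μ = C j k := by
  rw [← h.covariance_X j k, covariance_eq_sub (h.memLp_coord j) (h.memLp_coord k)]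
  simp [h.integral_coord]

theorem tendsto_sampleDeviation (h : IsDesignAndNoise μ 1 σ X ε) :
    ∀ᵐ ω ∂μ, Tendsto (fun n => sampleDeviation (fun i => X i ω) n) atTop (𝓝 0) := by
  have hjk : ∀ j k, ∀ᵐ ω ∂μ, Tendsto (fun n : ℕ =>
      (∑ i ∈ Finset.range n, X i ω j * X i ω k) / n) atTop
      (𝓝 ((1 : Matrix (Fin p) (Fin p) ℝ) j k)) := by
    intro j k
    have hm : Measurable fun x : EuclideanSpace ℝ (Fin p) => x j * x k := by fun_prop
    rw [← h.integral_coord_mul j k]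
    exact strong_law_ae_real (fun i ω => X i ω j * X i ω k)
      ((h.memLp_coord j).integrable_mul (h.memLp_coord k))
      (fun i i' hii => (h.iIndepFun_X.indepFun hii).comp hm hm)
      (fun i => (h.identDistrib_X i).comp hm)
  filter_upwards [ae_all_iff.2 fun j => ae_all_iff.2 (hjk j)] with ω hω
  have : Tendsto (fun n => sampleDeviation (fun i => X i ω) n) atTop
      (𝓝 (∑ j : Fin p, ∑ k : Fin p, |(1 : Matrix (Fin p) (Fin p) ℝ) j k -
        (1 : Matrix (Fin p) (Fin p) ℝ) j k|)) :=
    tendsto_finsetSum _ fun j _ => tendsto_finsetSum _ fun k _ =>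
      ((hω j k).sub_const _).abs
  simpa using this

theorem tendstoInMeasure_sampleDeviation (h : IsDesignAndNoise μ 1 σ X ε) :
    TendstoInMeasure μ (fun n ω => sampleDeviation (fun i => X i ω) n) atTop (fun _ => 0) := by
  refine tendstoInMeasure_of_tendsto_ae (fun n => AEMeasurable.aestronglyMeasurable ?_)
    h.tendsto_sampleDeviation
  have mX i j : AEMeasurable (fun ω => X i ω j) μ :=
    (by fun_prop : Measurable fun x : EuclideanSpace ℝ (Fin p) => x j).comp_aemeasurable
      (h.identDistrib_X i).aemeasurable_fst
  unfold sampleDeviation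
  fun_prop

theorem tendstoInDistribution_score (h : IsDesignAndNoise μ 1 σ X ε) :
    TendstoInDistribution (fun (n : ℕ) ω => (√n)⁻¹ • ∑ i ∈ Finset.range n, ε i ω • X i ω) atTop id
      (fun _ => μ) (isotropicGaussian p σ) := by
  have mX i := (h.identDistrib_X i).aemeasurable_fst
  have mε i := (h.identDistrib_ε i).aemeasurable_fst
  have hpair := iIndepFun.prodMk_of_indepFun mX mε h.iIndepFun_X h.iIndepFun_ε h.indepFun
  have msmul : Measurable fun q : EuclideanSpace ℝ (Fin p) × ℝ => q.2 • q.1 := by fun_prop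
  have hind : ∀ i, IndepFun (X i) (ε i) μ := fun i =>
    h.indepFun.comp (measurable_pi_apply i) (measurable_pi_apply i)
  have hindep : iIndepFun (fun i ω => ε i ω • X i ω) μ := hpair.comp _ fun _ => msmul
  have hident : ∀ i, IdentDistrib (fun ω => ε i ω • X i ω) (fun ω => ε 0 ω • X 0 ω) μ μ := fun i =>
    ((h.identDistrib_X i).prodMk (h.identDistrib_ε i) (hind i) (hind 0)).comp msmul
  have hε2 : ∫ ω, ε 0 ω ^ 2 ∂μ = σ ^ 2 := by
    rw [← h.variance_ε, variance_of_integral_eq_zero (mε 0) h.integral_ε]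
  refine tendstoInDistribution_isotropicGaussian hindep hident ?_ (fun t => ?_) (fun t => ?_)
  · have i1 : Integrable (fun ω => ‖X 0 ω‖ ^ 2) μ := h.memLp_X.integrable_norm_pow two_ne_zero
    have i2 : Integrable (fun ω => ε 0 ω ^ 2) μ := h.memLp_ε.integrable_sq
    have hi := ((hind 0).symm.comp (φ := fun y : ℝ => y ^ 2)
      (ψ := fun x : EuclideanSpace ℝ (Fin p) => ‖x‖ ^ 2) (by fun_prop)
      (by fun_prop)).integrable_mul i2 i1
    refine (memLp_two_iff_integrable_sq_norm (hident 0).aemeasurable_fst.aestronglyMeasurable).2 ?_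
    refine hi.congr (Eventually.of_forall fun ω => ?_)
    simp [norm_smul, mul_pow]
  · have hi := ((hind 0).symm.comp (φ := id)
      (ψ := fun x : EuclideanSpace ℝ (Fin p) => (inner ℝ x t : ℝ)) measurable_id
      (by fun_prop)).integral_mul_eq_mul_integral (mε 0).aestronglyMeasurable
      ((by fun_prop : Measurable fun x : EuclideanSpace ℝ (Fin p) =>
        (inner ℝ x t : ℝ)).comp_aemeasurable (mX 0)).aestronglyMeasurable
    simp only [Function.id_comp, h.integral_ε, zero_mul] at hi
    simpa [real_inner_smul_left] using hi
  · have hi := ((hind 0).symm.comp (φ := fun y : ℝ => y ^ 2)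
      (ψ := fun x : EuclideanSpace ℝ (Fin p) => (inner ℝ x t : ℝ) ^ 2) (by fun_prop)
      (by fun_prop)).integral_mul_eq_mul_integral ((mε 0).pow_const 2).aestronglyMeasurable
      ((by fun_prop : Measurable fun x : EuclideanSpace ℝ (Fin p) =>
        (inner ℝ x t : ℝ) ^ 2).comp_aemeasurable (mX 0)).aestronglyMeasurable
    have hX2 : ∫ ω, (inner ℝ (X 0 ω) t : ℝ) ^ 2 ∂μ = ‖t‖ ^ 2 := by
      have h1 : ∀ ω, (inner ℝ (X 0 ω) t : ℝ) ^ 2 =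
          ∑ j, ∑ k, t j * t k * (X 0 ω j * X 0 ω k) := by
        intro ω
        simp only [PiLp.inner_apply, RCLike.inner_apply, conj_trivial, sq, Finset.sum_mul_sum]
        exact Finset.sum_congr rfl fun j _ => Finset.sum_congr rfl fun k _ => by ring
      have hint : ∀ j k, Integrable (fun ω => t j * t k * (X 0 ω j * X 0 ω k)) μ := fun j k =>
        ((h.memLp_coord j).integrable_mul (h.memLp_coord k)).const_mul _
      simp_rw [h1]
      rw [integral_finsetSum _ fun j _ => integrable_finsetSum _ fun k _ => hint j k]
      simp_rw [integral_finsetSum _ fun k _ => hint _ k, integral_const_mul, h.integral_coord_mul]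
      rw [EuclideanSpace.real_norm_sq_eq]
      simp [Matrix.one_apply, sq]
    have h3 : ∀ ω, (inner ℝ (ε 0 ω • X 0 ω) t : ℝ) ^ 2 =
        ((fun y : ℝ => y ^ 2) ∘ ε 0 * (fun x : EuclideanSpace ℝ (Fin p) =>
          (inner ℝ x t : ℝ) ^ 2) ∘ X 0) ω := by
      intro ω
      simp [real_inner_smul_left, mul_pow]
    simp_rw [h3]
    rw [hi]
    simp only [Function.comp_apply, hε2, hX2]

/-- For a generalized Lasso estimator, the probability of recovering the pattern of `β₀` converges;
the limit is the probability that a Gaussian vector lies in the sum of the model space of `β₀` and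
the subdifferential of the penalty at `β₀`. -/
theorem tendsto_measureReal_genLassoPattern_eq {ι : Type*} [Fintype ι] (hσ : 0 < σ)
    (h : IsDesignAndNoise μ 1 σ X ε) (A : Matrix ι (Fin p) ℝ) {lam : ℝ} (hlam : 0 < lam)
    (β₀ : EuclideanSpace ℝ (Fin p)) {βhat : ℕ → Ω → EuclideanSpace ℝ (Fin p)}
    (hβhat : ∀ n, IsEstimator μ X (response X ε β₀) (genLasso A lam) n (βhat n)) :
    Tendsto (fun n => μ.real {ω | genLassoPattern A lam (βhat n ω) = genLassoPattern A lam β₀})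
      atTop (𝓝 ((isotropicGaussian p σ).real
        (dualBody (modelSpace (rowForm A) β₀)ᗮ (fun v => lam * l1Slope (rowForm A) β₀ v) 0))) := by
  refine tendsto_measureReal_of_dualBody_sandwich (isotropicGaussian_absolutelyContinuous p hσ.ne')
    h.tendstoInDistribution_score h.tendstoInMeasure_sampleDeviation _ _ fun η hη R => ?_
  set ρ := 4 * (R + lam * ∑ r, ‖rowForm A r‖) with hρ
  refine ⟨min (1 / 2) (η / (|ρ| + 1)), by positivity, ?_⟩
  -- The scaled true parameter `√n β₀` moves away from the hyperplanes that do not contain it.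
  have hfar : ∀ᶠ n : ℕ in atTop, ∀ r, rowForm A r (√n • β₀) ≠ 0 →
      ‖rowForm A r‖ * ρ < |rowForm A r (√n • β₀)| := by
    rw [eventually_all]
    intro r
    by_cases hr : rowForm A r β₀ = 0
    · exact Eventually.of_forall fun n h0 => absurd (by simp [hr]) h0
    · have : Tendsto (fun n : ℕ => √(n : ℝ) * |rowForm A r β₀|) atTop atTop :=
        (Real.tendsto_sqrt_atTop.comp tendsto_natCast_atTop_atTop).atTop_mul_const (abs_pos.2 hr)
      filter_upwards [this.eventually_gt_atTop (‖rowForm A r‖ * ρ)] with n hn _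
      rwa [map_smul, smul_eq_mul, abs_mul, abs_of_nonneg (Real.sqrt_nonneg _)]
  filter_upwards [hfar, eventually_ne_atTop 0] with n hn hn0
  filter_upwards [(hβhat n).2] with ω hmin hΔ hW
  have hs : 0 < √(n : ℝ) := Real.sqrt_pos.2 (by exact_mod_cast Nat.pos_of_ne_zero hn0)
  set x : ℕ → EuclideanSpace ℝ (Fin p) := fun i => X i ω with hx
  set W : EuclideanSpace ℝ (Fin p) := (√n)⁻¹ • ∑ i ∈ Finset.range n, ε i ω • X i ω with hWdef
  set u : EuclideanSpace ℝ (Fin p) := √n • (βhat n ω - β₀) with hu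
  have hβu : β₀ + (√n)⁻¹ • u = βhat n ω := by rw [hu, inv_smul_smul₀ hs.ne']; abel
  have hloc : ∀ v, localObjective (rowForm A) lam (sampleForm x n) W (√n • β₀) u ≤
      localObjective (rowForm A) lam (sampleForm x n) W (√n • β₀) v := by
    intro v
    have h1 := hmin (β₀ + (√n)⁻¹ • v)
    rw [← hβu] at h1
    have h2 := objective_eq_localObjective A lam hn0 x (fun i => ε i ω) β₀ u
    have h3 := objective_eq_localObjective A lam hn0 x (fun i => ε i ω) β₀ v
    simp only [response] at h1
    rw [h2, h3] at h1
    exact le_of_add_le_add_left h1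
  have hδ0 := sampleDeviation_nonneg x n
  rw [Real.norm_of_nonneg hδ0, lt_min_iff] at hΔ
  have hδη : sampleDeviation x n * ρ ≤ η := by
    have h1 := (lt_div_iff₀ (by positivity)).1 hΔ.2
    nlinarith [le_abs_self ρ]
  have hsignβ : ∀ r, SignType.sign (rowForm A r (√n • β₀)) = SignType.sign (rowForm A r β₀) := by
    intro r
    rw [map_smul, smul_eq_mul, sign_mul, sign_pos hs, one_mul]
  have hsignu : ∀ r, SignType.sign (rowForm A r (√n • β₀ + u)) =
      SignType.sign (rowForm A r (βhat n ω)) := by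
    intro r
    have : √n • β₀ + u = √n • βhat n ω := by rw [hu, ← smul_add]; congr 1; abel
    rw [this, map_smul, smul_eq_mul, sign_mul, sign_pos hs, one_mul]
  have hU : modelSpace (rowForm A) (√n • β₀) = modelSpace (rowForm A) β₀ := by
    ext v
    simp only [mem_modelSpace, map_smul, smul_eq_mul, mul_eq_zero, hs.ne', false_or]
  have hD : (fun v => lam * l1Slope (rowForm A) (√n • β₀) v) =
      fun v => lam * l1Slope (rowForm A) β₀ v := by
    funext v; rw [l1Slope_congr hsignβ]
  change (genLassoPattern A lam (βhat n ω) = genLassoPattern A lam β₀ → _) ∧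
    (_ → genLassoPattern A lam (βhat n ω) = genLassoPattern A lam β₀)
  rw [genLassoPattern_eq_iff A hlam]
  constructor
  · intro hpat
    have h1 := mem_dualBody_of_sign_eq hlam.le (sampleForm_comm x n)
      (abs_sampleForm_sub_inner_le x n) hδ0 hΔ.1.le hW hloc fun r => by
        rw [hsignu, hpat r, hsignβ]
    rw [hU, hD] at h1
    exact dualBody_mono _ _ hδη h1
  · intro hmem r
    have h1 := dualBody_mono _ _ (neg_le_neg hδη) hmem
    rw [← hU, ← hD] at h1
    have h2 := sign_eq_of_mem_dualBody hlam.le (sampleForm_comm x n)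
      (abs_sampleForm_sub_inner_le x n) hδ0 hΔ.1.le hW hloc hn h1 r
    rw [← hsignu, h2, hsignβ]

end IsDesignAndNoise

end Asymptotics

/-! ### Strictly concave sequences -/

/-- Discrete Taylor expansion with second differences as remainder. -/
theorem discrete_taylor (b : ℕ → ℝ) (n : ℕ) :
    b n = b 0 + (b 1 - b 0) * n -
      ∑ k ∈ Finset.range n, (2 * b (k + 1) - b k - b (k + 2)) * ((n : ℝ) - (k + 1)) := by
  have hsum : ∀ n, ∑ k ∈ Finset.range n, (2 * b (k + 1) - b k - b (k + 2)) =
      (b 1 - b 0) - (b (n + 1) - b n) := by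
    intro n
    induction n with
    | zero => simp
    | succ n ih => rw [Finset.sum_range_succ, ih]; ring
  induction n with
  | zero => simp
  | succ n ih =>
    rw [Finset.sum_range_succ]
    have h1 : ∑ k ∈ Finset.range n,
        (2 * b (k + 1) - b k - b (k + 2)) * (((n + 1 : ℕ) : ℝ) - (k + 1)) =
        ∑ k ∈ Finset.range n, (2 * b (k + 1) - b k - b (k + 2)) * ((n : ℝ) - (k + 1)) +
          ∑ k ∈ Finset.range n, (2 * b (k + 1) - b k - b (k + 2)) := by
      rw [← Finset.sum_add_distrib]
      exact Finset.sum_congr rfl fun k _ => by push_cast; ring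
    rw [h1, hsum n]
    push_cast
    linarith

/-- A finite sequence with negative second differences is strictly concave: subtracting a small
multiple of `x ^ 2` keeps room for a piecewise linear concave interpolation. -/
theorem strictConcaveSeq_of_second_diff {p : ℕ} {a : ℕ → ℝ}
    (h : ∀ k, k + 1 < p → a k + a (k + 2) < 2 * a (k + 1)) : StrictConcaveSeq p a := by
  obtain ⟨e, he, hea⟩ : ∃ e > 0, ∀ k ∈ Finset.range (p - 1),
      2 * e < 2 * a (k + 1) - a k - a (k + 2) := by
    have h1 : ∀ᶠ e : ℝ in 𝓝[>] 0, ∀ k ∈ Finset.range (p - 1),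
        2 * e < 2 * a (k + 1) - a k - a (k + 2) := by
      rw [Filter.eventually_all_finset]
      intro k hk
      have hpos : 0 < 2 * a (k + 1) - a k - a (k + 2) := by
        have := h k (by have := Finset.mem_range.1 hk; omega)
        linarith
      have hlim : Tendsto (fun e : ℝ => 2 * e) (𝓝[>] 0) (𝓝 0) := by
        have hc : Continuous fun e : ℝ => 2 * e := by fun_prop
        have := hc.tendsto 0
        rw [mul_zero] at this
        exact this.mono_left nhdsWithin_le_nhds
      exact hlim.eventually_lt_const hpos
    obtain ⟨e, h2, h3⟩ := (h1.and self_mem_nhdsWithin).exists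
    exact ⟨e, h3, h2⟩
  set b : ℕ → ℝ := fun n => a n + e * (n : ℝ) ^ 2 with hb
  set c : ℕ → ℝ := fun k => 2 * b (k + 1) - b k - b (k + 2) with hc
  have hc0 : ∀ k ∈ Finset.range (p - 1), 0 ≤ c k := by
    intro k hk
    have := hea k hk
    simp only [hc, hb]
    push_cast
    linarith
  refine ⟨fun x => -(e * x ^ 2) + (b 0 + (b 1 - b 0) * x +
    ∑ k ∈ Finset.range (p - 1), c k * -max (x - (k + 1)) 0), ?_, ?_⟩
  · have hsq : StrictConcaveOn ℝ Set.univ fun x : ℝ => -(e * x ^ 2) := by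
      refine ⟨convex_univ, fun x _ y _ hxy s t hs ht hst => ?_⟩
      obtain rfl : t = 1 - s := by linarith
      have : 0 < e * (s * (1 - s)) * (x - y) ^ 2 := by
        have := sq_pos_of_ne_zero (sub_ne_zero.2 hxy)
        positivity
      simp only [smul_eq_mul]
      nlinarith
    refine hsq.add_concaveOn ⟨convex_univ, fun x _ y _ s t hs ht hst => ?_⟩
    have hk : ∀ k ∈ Finset.range (p - 1), s * (c k * -max (x - (k + 1)) 0) +
        t * (c k * -max (y - (k + 1)) 0) ≤ c k * -max (s * x + t * y - (k + 1)) 0 := by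
      intro k hk
      have h1 : max (s * x + t * y - (k + 1)) 0 ≤
          s * max (x - (k + 1)) 0 + t * max (y - (k + 1)) 0 := by
        refine max_le ?_ (by positivity)
        have h2 := mul_le_mul_of_nonneg_left (le_max_left (x - ((k : ℝ) + 1)) 0) hs
        have h3 := mul_le_mul_of_nonneg_left (le_max_left (y - ((k : ℝ) + 1)) 0) ht
        have h4 : ((k : ℝ) + 1) = s * (k + 1) + t * (k + 1) := by rw [← add_mul, hst, one_mul]
        linarith
      have := mul_le_mul_of_nonneg_left h1 (hc0 k hk)
      linarith
    have hsum := Finset.sum_le_sum hk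
    rw [Finset.sum_add_distrib, ← Finset.mul_sum, ← Finset.mul_sum] at hsum
    have h5 : b 0 = s * b 0 + t * b 0 := by rw [← add_mul, hst, one_mul]
    simp only [smul_eq_mul]
    linarith
  · intro n hn
    have h1 : ∑ k ∈ Finset.range (p - 1), c k * -max ((n : ℝ) - (k + 1)) 0 =
        ∑ k ∈ Finset.range p, c k * -max ((n : ℝ) - (k + 1)) 0 := by
      refine Finset.sum_subset (Finset.range_mono (Nat.sub_le _ _)) fun k hk hk' => ?_
      simp only [Finset.mem_range, not_lt] at hk hk'
      have : (n : ℝ) ≤ k + 1 := by exact_mod_cast (by omega : n ≤ k + 1)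
      rw [max_eq_right (by linarith), neg_zero, mul_zero]
    have h2 : ∑ k ∈ Finset.range n, c k * -max ((n : ℝ) - (k + 1)) 0 =
        ∑ k ∈ Finset.range p, c k * -max ((n : ℝ) - (k + 1)) 0 := by
      refine Finset.sum_subset (Finset.range_mono hn) fun k hk hk' => ?_
      simp only [Finset.mem_range, not_lt] at hk hk'
      have : (n : ℝ) ≤ k + 1 := by exact_mod_cast (by omega : n ≤ k + 1)
      rw [max_eq_right (by linarith), neg_zero, mul_zero]
    have h3 : ∑ k ∈ Finset.range n, c k * -max ((n : ℝ) - (k + 1)) 0 =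
        -∑ k ∈ Finset.range n, c k * ((n : ℝ) - (k + 1)) := by
      rw [← Finset.sum_neg_distrib]
      refine Finset.sum_congr rfl fun k hk => ?_
      have : ((k : ℝ) + 1) ≤ n := by exact_mod_cast (by simpa using hk : k + 1 ≤ n)
      rw [max_eq_left (by linarith), mul_neg]
    have h4 := discrete_taylor b n
    beta_reduce
    rw [h1, ← h2, h3]
    have h5 : b n = a n + e * (n : ℝ) ^ 2 := rfl
    linarith

theorem StrictConcaveSeq.lt_of_lt {p : ℕ} {a : ℕ → ℝ} (h : StrictConcaveSeq p a) {l i m : ℕ}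
    (hli : l < i) (him : i < m) (hm : m ≤ p) :
    (1 - ((i : ℝ) - l) / ((m : ℝ) - l)) * a l + ((i : ℝ) - l) / ((m : ℝ) - l) * a m < a i := by
  obtain ⟨F, hF, haF⟩ := h
  have h1 : (l : ℝ) < i := by exact_mod_cast hli
  have h2 : (i : ℝ) < m := by exact_mod_cast him
  have h3 : (0 : ℝ) < (m : ℝ) - l := by linarith
  have h4 : ((i : ℝ) - l) / ((m : ℝ) - l) < 1 := (div_lt_one h3).2 (by linarith)
  have := hF.2 (Set.mem_univ (l : ℝ)) (Set.mem_univ (m : ℝ)) (by linarith : (l : ℝ) < m).ne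
    (sub_pos.2 h4) (div_pos (sub_pos.2 h1) h3) (by ring)
  have hi : (1 - ((i : ℝ) - l) / ((m : ℝ) - l)) * l + ((i : ℝ) - l) / ((m : ℝ) - l) * m = i := by
    have h5 := h3.ne'
    field_simp
    ring
  simp only [smul_eq_mul, hi] at this
  rwa [haF l (by omega), haF i (by omega), haF m hm]

/-- Prescribe the value `± a i` at the marked indices and `0` at both ends, and interpolate
linearly in between. Strict concavity keeps the interpolation strictly below `a` in absolute
value. -/
theorem StrictConcaveSeq.exists_interpolation {p : ℕ} {a : ℕ → ℝ} (h : StrictConcaveSeq p a)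
    (ha_zero : a 0 = 0) (ha_last : a p = 0) (ha : ∀ i ≤ p, 0 ≤ a i) (J : ℕ → Prop) (v : ℕ → ℝ)
    (hv : ∀ i, |v i| ≤ 1) :
    ∃ t : ℕ → ℝ, t 0 = 0 ∧ t p = 0 ∧ ∀ i, 0 < i → i < p →
      (J i → t i = v i * a i) ∧ (¬ J i → |t i| < a i ∧ t (i + 1) - t i = t i - t (i - 1)) := by
  classical
  have key : ∀ m ≤ p, ∃ t : ℕ → ℝ, t 0 = 0 ∧ t m = v m * a m ∧ ∀ i, 0 < i → i < m →
      (J i → t i = v i * a i) ∧ (¬ J i → |t i| < a i ∧ t (i + 1) - t i = t i - t (i - 1)) := by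
    intro m
    induction m using Nat.strong_induction_on with
    | _ m ih =>
    intro hmp
    rcases Nat.eq_zero_or_pos m with rfl | hm
    · exact ⟨0, rfl, by simp [ha_zero], fun i h1 h2 => absurd h2 (Nat.not_lt_zero i)⟩
    -- `l` is the last marked index before `m`.
    set l := Nat.findGreatest (fun k => k = 0 ∨ J k) (m - 1) with hl
    have hlm : l < m := lt_of_le_of_lt (Nat.findGreatest_le _) (by omega)
    have hlJ : l = 0 ∨ J l :=
      Nat.findGreatest_spec (P := fun k => k = 0 ∨ J k) (Nat.zero_le _) (Or.inl rfl)
    have hnJ : ∀ i, l < i → i < m → ¬ J i := fun i h1 h2 h3 =>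
      Nat.findGreatest_is_greatest (P := fun k => k = 0 ∨ J k) h1 (by omega) (Or.inr h3)
    obtain ⟨t, ht0, htl, ht⟩ := ih l hlm (hlm.le.trans hmp)
    have hml : (0 : ℝ) < (m : ℝ) - l := sub_pos.2 (by exact_mod_cast hlm)
    set g : ℕ → ℝ := fun k => v l * a l + ((k : ℝ) - l) / ((m : ℝ) - l) * (v m * a m - v l * a l)
      with hg
    set t' : ℕ → ℝ := fun k => if k ≤ l then t k else g k with ht'
    have ht'g : ∀ k, l ≤ k → t' k = g k := by
      intro k hk
      rcases hk.eq_or_lt with rfl | hk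
      · simp only [ht', hg, le_refl, if_true, htl, sub_self, zero_div, zero_mul, add_zero]
      · simp only [ht', not_le.2 hk, if_false]
    have ht't : ∀ k, k ≤ l → t' k = t k := fun k hk => if_pos hk
    refine ⟨t', by rw [ht't 0 (Nat.zero_le _), ht0], ?_, fun i hi0 him => ?_⟩
    · rw [ht'g m hlm.le]
      simp only [hg, div_self hml.ne']
      ring
    rcases lt_trichotomy i l with hil | rfl | hil
    · rw [ht't i hil.le, ht't (i + 1) hil, ht't (i - 1) (by omega)]
      exact ht i hi0 hil
    · refine ⟨fun _ => by rw [ht't _ le_rfl, htl], fun hn => ?_⟩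
      exact absurd (hlJ.resolve_left hi0.ne') hn
    · refine ⟨fun hJ => absurd hJ (hnJ i hil him), fun _ => ?_⟩
      rw [ht'g i hil.le, ht'g (i + 1) (by omega), ht'g (i - 1) (by omega)]
      constructor
      · have hlt := h.lt_of_lt hil him hmp
        set θ := ((i : ℝ) - l) / ((m : ℝ) - l) with hθ
        have hθ0 : 0 ≤ θ := div_nonneg (sub_nonneg.2 (by exact_mod_cast hil.le)) hml.le
        have hθ1 : 0 ≤ 1 - θ := by
          rw [sub_nonneg, hθ, div_le_one hml]
          have : (i : ℝ) ≤ m := by exact_mod_cast him.le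
          linarith
        have hva : ∀ k ≤ p, |v k * a k| ≤ a k := fun k hk => by
          rw [abs_mul, abs_of_nonneg (ha k hk)]
          exact mul_le_of_le_one_left (ha k hk) (hv k)
        have h1 : g i = (1 - θ) * (v l * a l) + θ * (v m * a m) := by
          simp only [hg, ← hθ]; ring
        rw [h1]
        refine lt_of_le_of_lt ((abs_add_le _ _).trans ?_) hlt
        rw [abs_mul (1 - θ), abs_mul θ, abs_of_nonneg hθ0, abs_of_nonneg hθ1]
        gcongr
        · exact hva l (hlm.le.trans hmp)
        · exact hva m hmp
      · simp only [hg]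
        rw [Nat.cast_sub (by omega : 1 ≤ i)]
        push_cast
        ring
  obtain ⟨t, h0, hp, ht⟩ := key p le_rfl
  exact ⟨t, h0, by rw [hp, ha_last, mul_zero], ht⟩

/-! ### Positivity of the slopes of the Fused Lasso -/

section FusedLasso

variable {p : ℕ} {a : ℕ → ℝ} {κ : ℝ}

theorem rowForm_fusedLassoMatrix_inl (i : Fin (p - 1)) (x : EuclideanSpace ℝ (Fin p)) :
    rowForm (fusedLassoMatrix p a κ) (Sum.inl i) x =
      a (i + 1) * (x ⟨i + 1, by omega⟩ - x ⟨i, by omega⟩) := by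
  change (a (i + 1) • (Pi.single (⟨i + 1, by omega⟩ : Fin p) (1 : ℝ)
    - Pi.single (⟨i, by omega⟩ : Fin p) 1)) ⬝ᵥ x.ofLp = _
  rw [smul_dotProduct, sub_dotProduct, single_one_dotProduct, single_one_dotProduct, smul_eq_mul]

theorem rowForm_fusedLassoMatrix_inr (j : Fin p) (x : EuclideanSpace ℝ (Fin p)) :
    rowForm (fusedLassoMatrix p a κ) (Sum.inr j) x = κ * x j := by
  change (κ • Pi.single j (1 : ℝ)) ⬝ᵥ x.ofLp = _
  rw [smul_dotProduct, single_one_dotProduct, smul_eq_mul]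

theorem l1Slope_fusedLassoMatrix (ha : ∀ i, 0 < i → i < p → 0 < a i) (hκ : 0 < κ)
    (x h : EuclideanSpace ℝ (Fin p)) :
    l1Slope (rowForm (fusedLassoMatrix p a κ)) x h =
      ∑ i : Fin (p - 1), a (i + 1) * absSlope (x ⟨i + 1, by omega⟩ - x ⟨i, by omega⟩)
        (h ⟨i + 1, by omega⟩ - h ⟨i, by omega⟩) + ∑ j, κ * absSlope (x j) (h j) := by
  rw [l1Slope, Fintype.sum_sum_type]
  congr 1
  · refine Finset.sum_congr rfl fun i _ => ?_
    rw [rowForm_fusedLassoMatrix_inl, rowForm_fusedLassoMatrix_inl,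
      absSlope_mul_mul (ha _ (by omega) (by omega))]
  · refine Finset.sum_congr rfl fun j _ => ?_
    rw [rowForm_fusedLassoMatrix_inr, rowForm_fusedLassoMatrix_inr, absSlope_mul_mul hκ]

theorem mem_modelSpace_fusedLassoMatrix (ha : ∀ i, 0 < i → i < p → 0 < a i) (hκ : 0 < κ)
    {x u : EuclideanSpace ℝ (Fin p)} :
    u ∈ modelSpace (rowForm (fusedLassoMatrix p a κ)) x ↔
      (∀ i : Fin (p - 1), x ⟨i + 1, by omega⟩ = x ⟨i, by omega⟩ →
        u ⟨i + 1, by omega⟩ = u ⟨i, by omega⟩) ∧ ∀ j, x j = 0 → u j = 0 := by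
  have hai : ∀ i : Fin (p - 1), a (i + 1) ≠ 0 := fun i => (ha _ (by omega) (by omega)).ne'
  simp only [mem_modelSpace, Sum.forall, rowForm_fusedLassoMatrix_inl,
    rowForm_fusedLassoMatrix_inr, mul_eq_zero, hai, hκ.ne', false_or, sub_eq_zero]

/-- Summation by parts. -/
theorem sum_mul_sub_eq_sum_sub_mul (hp : 1 ≤ p) {t : ℕ → ℝ} (t_zero : t 0 = 0) (t_last : t p = 0)
    (h : Fin p → ℝ) :
    ∑ i : Fin (p - 1), t (i + 1) * (h ⟨i + 1, by omega⟩ - h ⟨i, by omega⟩) =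
      ∑ j : Fin p, (t j - t (j + 1)) * h j := by
  obtain ⟨m, rfl⟩ : ∃ m, p = m + 1 := ⟨p - 1, by omega⟩
  have h1 : ∑ j : Fin (m + 1), t j * h j = ∑ i : Fin m, t (i + 1) * h i.succ := by
    rw [Fin.sum_univ_succ]
    simp [t_zero]
  have h2 : ∑ j : Fin (m + 1), t (j + 1) * h j = ∑ i : Fin m, t (i + 1) * h i.castSucc := by
    rw [Fin.sum_univ_castSucc]
    simp [t_last]
  simp only [mul_sub, sub_mul, Finset.sum_sub_distrib]
  rw [h1, h2]
  rfl

/-- A vector of dual variables `t` on the edges, strictly inside the admissible range where the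
coefficients of `x` are fused and with constant increments along nonzero blocks, certifies that
all nontrivial slopes orthogonal to the model space are positive. -/
theorem l1Slope_fusedLassoMatrix_pos (hp : 1 ≤ p) (ha_zero : a 0 = 0) (ha_last : a p = 0)
    (ha : ∀ i, 0 < i → i < p → 0 < a i) (hκ : 0 < κ) (hconc : StrictConcaveSeq p a)
    (hlt : ∀ i < p, a i + a (i + 1) < κ) {x h : EuclideanSpace ℝ (Fin p)}
    (hh : h ∈ (modelSpace (rowForm (fusedLassoMatrix p a κ)) x)ᗮ) (h0 : h ≠ 0) :
    0 < l1Slope (rowForm (fusedLassoMatrix p a κ)) x h := by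
  have ha' : ∀ i ≤ p, 0 ≤ a i := by
    intro i hi
    rcases Nat.eq_zero_or_pos i with rfl | hi0
    · exact ha_zero.ge
    · rcases hi.eq_or_lt with rfl | hi
      · exact ha_last.ge
      · exact (ha i hi0 hi).le
  set xs : ℕ → ℝ := fun j => if hj : j < p then x ⟨j, hj⟩ else 0 with hxs
  have xs_eq : ∀ j (hj : j < p), xs j = x ⟨j, hj⟩ := fun j hj => dif_pos hj
  obtain ⟨t, t_zero, t_last, ht⟩ := hconc.exists_interpolation ha_zero ha_last ha'
    (fun i => xs i ≠ xs (i - 1)) (fun i => (SignType.sign (xs i - xs (i - 1)) : ℝ)) fun i => by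
      rcases lt_trichotomy (xs i - xs (i - 1)) 0 with hs | hs | hs
      · simp [sign_neg hs]
      · simp [hs]
      · simp [sign_pos hs]
  have ht_jump : ∀ i (hi : i < p - 1), x ⟨i + 1, by omega⟩ ≠ x ⟨i, by omega⟩ →
      t (i + 1) = (SignType.sign (x ⟨i + 1, by omega⟩ - x ⟨i, by omega⟩) : ℝ) * a (i + 1) := by
    intro i hi hne
    have := (ht (i + 1) (by omega) (by omega)).1
    rw [Nat.add_sub_cancel, xs_eq _ (by omega), xs_eq _ (by omega)] at this
    exact this hne
  have ht_fused : ∀ i (hi : i < p - 1), x ⟨i + 1, by omega⟩ = x ⟨i, by omega⟩ →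
      |t (i + 1)| < a (i + 1) ∧ t (i + 2) - t (i + 1) = t (i + 1) - t i := by
    intro i hi heq
    have := (ht (i + 1) (by omega) (by omega)).2
    rw [Nat.add_sub_cancel, xs_eq _ (by omega), xs_eq _ (by omega)] at this
    exact this (not_not.2 heq)
  have ht_le : ∀ i ≤ p, |t i| ≤ a i := by
    intro i hi
    rcases Nat.eq_zero_or_pos i with rfl | hi0
    · rw [t_zero, ha_zero, abs_zero]
    rcases hi.eq_or_lt with rfl | hip
    · rw [t_last, ha_last, abs_zero]
    obtain ⟨k, rfl⟩ : ∃ k, i = k + 1 := ⟨i - 1, by omega⟩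
    by_cases heq : x ⟨k + 1, by omega⟩ = x ⟨k, by omega⟩
    · exact (ht_fused k (by omega) heq).1.le
    · rw [ht_jump k (by omega) heq, abs_mul, abs_of_pos (ha _ hi0 hip)]
      refine mul_le_of_le_one_left (ha _ hi0 hip).le ?_
      rcases lt_or_gt_of_ne (sub_ne_zero.2 heq) with hs | hs
      · simp [sign_neg hs]
      · simp [sign_pos hs]
  -- The part of the dual vector on the support of `x` lies in the model space.
  set g : EuclideanSpace ℝ (Fin p) := WithLp.toLp 2 fun j : Fin p =>
    if x j = 0 then 0 else t j - t (j + 1) + κ * (SignType.sign (x j) : ℝ) with hg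
  have g_apply : ∀ j, g j =
      if x j = 0 then 0 else t j - t (j + 1) + κ * (SignType.sign (x j) : ℝ) := fun j => rfl
  have hgU : g ∈ modelSpace (rowForm (fusedLassoMatrix p a κ)) x := by
    rw [mem_modelSpace_fusedLassoMatrix ha hκ]
    refine ⟨fun i hi => ?_, fun j hj => by rw [g_apply, if_pos hj]⟩
    rw [g_apply, g_apply, hi]
    have := (ht_fused i i.2 hi).2
    split_ifs
    · rfl
    · change t (i + 1) - t (i + 2) + _ = _
      linarith
  have hgh : ∑ j, g j * h j = 0 := by
    have := Submodule.inner_right_of_mem_orthogonal hgU hh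
    rw [PiLp.inner_apply] at this
    simpa [mul_comm] using this
  have hedge : ∀ i : Fin (p - 1), t (i + 1) * (h ⟨i + 1, by omega⟩ - h ⟨i, by omega⟩) ≤
      a (i + 1) * absSlope (x ⟨i + 1, by omega⟩ - x ⟨i, by omega⟩)
        (h ⟨i + 1, by omega⟩ - h ⟨i, by omega⟩) ∧
      (x ⟨i + 1, by omega⟩ = x ⟨i, by omega⟩ → h ⟨i + 1, by omega⟩ ≠ h ⟨i, by omega⟩ →
        t (i + 1) * (h ⟨i + 1, by omega⟩ - h ⟨i, by omega⟩) <
        a (i + 1) * absSlope (x ⟨i + 1, by omega⟩ - x ⟨i, by omega⟩)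
          (h ⟨i + 1, by omega⟩ - h ⟨i, by omega⟩)) := by
    intro i
    by_cases heq : x ⟨i + 1, by omega⟩ = x ⟨i, by omega⟩
    · rw [heq, sub_self, absSlope_zero_left]
      have hb : t (i + 1) * (h ⟨i + 1, by omega⟩ - h ⟨i, by omega⟩) ≤
          |t (i + 1)| * |h ⟨i + 1, by omega⟩ - h ⟨i, by omega⟩| := by
        rw [← abs_mul]; exact le_abs_self _
      have hta := (ht_fused i i.2 heq).1
      refine ⟨hb.trans (by gcongr), fun _ hne => hb.trans_lt ?_⟩
      exact mul_lt_mul_of_pos_right hta (abs_pos.2 (sub_ne_zero.2 hne))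
    · refine ⟨?_, fun hc => absurd hc heq⟩
      rw [absSlope, if_neg (sub_ne_zero.2 heq), ht_jump i i.2 heq]
      exact le_of_eq (by ring)
  have hvertex : ∀ j : Fin p, (g j - (t j - t (j + 1))) * h j ≤ κ * absSlope (x j) (h j) ∧
      (x j = 0 → h j ≠ 0 → (g j - (t j - t (j + 1))) * h j < κ * absSlope (x j) (h j)) := by
    intro j
    by_cases hxj : x j = 0
    · rw [g_apply, if_pos hxj, hxj, absSlope_zero_left, zero_sub]
      have hb : -(t j - t (j + 1)) * h j ≤ |t j - t (j + 1)| * |h j| := by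
        rw [← abs_neg (t j - _), ← abs_mul]; exact le_abs_self _
      have htκ : |t j - t (j + 1)| < κ :=
        ((abs_sub _ _).trans (add_le_add (ht_le j j.2.le) (ht_le (j + 1) j.2))).trans_lt
          (hlt j j.2)
      refine ⟨hb.trans (by gcongr), fun _ hne => hb.trans_lt ?_⟩
      exact mul_lt_mul_of_pos_right htκ (abs_pos.2 hne)
    · refine ⟨?_, fun hc => absurd hc hxj⟩
      rw [g_apply, if_neg hxj, absSlope, if_neg hxj]
      exact le_of_eq (by ring)
  have hsum : ∑ i : Fin (p - 1), t (i + 1) * (h ⟨i + 1, by omega⟩ - h ⟨i, by omega⟩) +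
      ∑ j : Fin p, (g j - (t j - t (j + 1))) * h j = 0 := by
    rw [sum_mul_sub_eq_sum_sub_mul hp t_zero t_last h.ofLp]
    simp only [sub_mul, Finset.sum_sub_distrib, hgh]
    ring
  rw [l1Slope_fusedLassoMatrix ha hκ, ← hsum]
  have hle1 := Finset.sum_le_sum fun i (_ : i ∈ Finset.univ) => (hedge i).1
  have hle2 := Finset.sum_le_sum fun j (_ : j ∈ Finset.univ) => (hvertex j).1
  -- Without any strict inequality, `h` would lie in the model space.
  by_cases hmem : h ∈ modelSpace (rowForm (fusedLassoMatrix p a κ)) x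
  · exact absurd (inner_self_eq_zero.1 (Submodule.inner_right_of_mem_orthogonal hmem hh)) h0
  rw [mem_modelSpace_fusedLassoMatrix ha hκ, not_and_or] at hmem
  rcases hmem with hmem | hmem
  · push Not at hmem
    obtain ⟨i, hi, hne⟩ := hmem
    exact add_lt_add_of_lt_of_le (Finset.sum_lt_sum (fun i _ => (hedge i).1)
      ⟨i, Finset.mem_univ _, (hedge i).2 hi hne⟩) hle2
  · push Not at hmem
    obtain ⟨j, hj, hne⟩ := hmem
    exact add_lt_add_of_le_of_lt hle1 (Finset.sum_lt_sum (fun j _ => (hvertex j).1)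
      ⟨j, Finset.mem_univ _, (hvertex j).2 hj hne⟩)

/-- Testing with a coefficient vector that decreases strictly to a single zero and increases strictly
afterwards shows that the sparsity weight dominates the sum of two adjacent clustering weights. -/
theorem add_lt_of_l1Slope_pos (hp : 1 ≤ p) (ha_zero : a 0 = 0) (ha_last : a p = 0)
    (ha : ∀ i, 0 < i → i < p → 0 < a i) (hκ : 0 < κ)
    (hpos : ∀ x, ∀ h ∈ (modelSpace (rowForm (fusedLassoMatrix p a κ)) x)ᗮ, h ≠ 0 →
      0 < l1Slope (rowForm (fusedLassoMatrix p a κ)) x h) {k : ℕ} (hk : k < p) :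
    a k + a (k + 1) < κ := by
  set x : EuclideanSpace ℝ (Fin p) := WithLp.toLp 2 fun j => |((j : ℕ) : ℝ) - k| with hx
  set h : EuclideanSpace ℝ (Fin p) := EuclideanSpace.single ⟨k, hk⟩ 1 with hh
  have x_apply : ∀ j : Fin p, x j = |((j : ℕ) : ℝ) - k| := fun j => rfl
  have h_apply : ∀ j : Fin p, h j = if j = ⟨k, hk⟩ then 1 else 0 := fun j => by
    simp [hh]
  have hmem : h ∈ (modelSpace (rowForm (fusedLassoMatrix p a κ)) x)ᗮ := by
    rw [Submodule.mem_orthogonal]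
    intro u hu
    have := (mem_modelSpace_fusedLassoMatrix ha hκ).1 hu
    rw [hh, EuclideanSpace.inner_single_right, this.2 ⟨k, hk⟩ (by simp [x_apply])]
    simp
  have h0 : h ≠ 0 := fun h0 => by
    have := h_apply ⟨k, hk⟩
    rw [h0] at this
    simp at this
  have := hpos x h hmem h0
  rw [l1Slope_fusedLassoMatrix ha hκ] at this
  -- On every edge the slope is linear in `h`, with coefficient the sign of the jump times `a`.
  set t : ℕ → ℝ := fun i => if i ≤ k then -a i else a i with ht
  have hedge : ∀ i : Fin (p - 1), a (i + 1) * absSlope (x ⟨i + 1, by omega⟩ - x ⟨i, by omega⟩)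
      (h ⟨i + 1, by omega⟩ - h ⟨i, by omega⟩) =
      t (i + 1) * (h ⟨i + 1, by omega⟩ - h ⟨i, by omega⟩) := by
    intro i
    rw [x_apply, x_apply]
    simp only [ht]
    split_ifs with hik
    · have h1 : (((i : ℕ) + 1 : ℕ) : ℝ) ≤ k := by exact_mod_cast hik
      push_cast at h1 ⊢
      rw [abs_of_nonpos (by linarith), abs_of_nonpos (by linarith), absSlope_of_neg (by linarith)]
      ring
    · have h1 : (k : ℝ) ≤ (i : ℕ) := by exact_mod_cast (by omega : k ≤ (i : ℕ))
      push_cast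
      rw [abs_of_nonneg (by linarith), abs_of_nonneg (by linarith), absSlope_of_pos (by linarith)]
  have hvertex : ∀ j : Fin p, κ * absSlope (x j) (h j) = if j = ⟨k, hk⟩ then κ else 0 := by
    intro j
    rw [h_apply]
    split_ifs with hj
    · rw [hj, x_apply]
      simp [absSlope_zero_left]
    · simp [absSlope]
  simp only [hedge, hvertex] at this
  rw [sum_mul_sub_eq_sum_sub_mul hp (by simp [ht, ha_zero]) (by simp [ht, ha_last]) h.ofLp] at this
  simp only [h_apply, mul_ite, mul_one, mul_zero, Finset.sum_ite_eq', Finset.mem_univ,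
    if_true, ht, le_refl, Nat.not_succ_le_self, if_false] at this
  linarith

/-- Testing with a positive coefficient vector that is strictly increasing up to a single tie shows
that the clustering weights are strictly concave at the tie. -/
theorem second_diff_of_l1Slope_pos (hp : 1 ≤ p) (ha_zero : a 0 = 0) (ha_last : a p = 0)
    (ha : ∀ i, 0 < i → i < p → 0 < a i) (hκ : 0 < κ)
    (hpos : ∀ x, ∀ h ∈ (modelSpace (rowForm (fusedLassoMatrix p a κ)) x)ᗮ, h ≠ 0 →
      0 < l1Slope (rowForm (fusedLassoMatrix p a κ)) x h) {k : ℕ} (hk : k + 1 < p) :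
    a k + a (k + 2) < 2 * a (k + 1) := by
  set x : EuclideanSpace ℝ (Fin p) :=
    WithLp.toLp 2 fun j => if (j : ℕ) ≤ k then ((j : ℕ) : ℝ) + 1 else (j : ℕ) with hx
  have x_apply : ∀ j : Fin p, x j = if (j : ℕ) ≤ k then ((j : ℕ) : ℝ) + 1 else (j : ℕ) :=
    fun j => rfl
  set h : EuclideanSpace ℝ (Fin p) :=
    EuclideanSpace.single ⟨k + 1, hk⟩ 1 - EuclideanSpace.single ⟨k, by omega⟩ 1 with hh
  have h_apply : ∀ j : Fin p, h j =
      (if j = ⟨k + 1, hk⟩ then 1 else 0) - (if j = ⟨k, by omega⟩ then 1 else 0) := fun j => by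
    simp [hh]
  have h_sum : ∀ c : Fin p → ℝ, ∑ j, c j * h j = c ⟨k + 1, hk⟩ - c ⟨k, by omega⟩ := by
    intro c
    simp [h_apply, mul_sub, Finset.sum_sub_distrib]
  have x_pos : ∀ j, 0 < x j := by
    intro j
    rw [x_apply]
    split_ifs with hj
    · positivity
    · exact Nat.cast_pos.2 (by omega)
  have hmem : h ∈ (modelSpace (rowForm (fusedLassoMatrix p a κ)) x)ᗮ := by
    rw [Submodule.mem_orthogonal]
    intro u hu
    have := ((mem_modelSpace_fusedLassoMatrix ha hκ).1 hu).1 ⟨k, by omega⟩ (by simp [x_apply])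
    rw [hh, inner_sub_right, EuclideanSpace.inner_single_right, EuclideanSpace.inner_single_right]
    simp only [conj_trivial, one_mul]
    exact sub_eq_zero.2 this
  have h0 : h ≠ 0 := fun h0 => by
    have := h_apply ⟨k + 1, hk⟩
    rw [h0] at this
    simp at this
  have := hpos x h hmem h0
  rw [l1Slope_fusedLassoMatrix ha hκ] at this
  have hedge : ∀ i : Fin (p - 1), a (i + 1) * absSlope (x ⟨i + 1, by omega⟩ - x ⟨i, by omega⟩)
      (h ⟨i + 1, by omega⟩ - h ⟨i, by omega⟩) =
      a (i + 1) * (h ⟨i + 1, by omega⟩ - h ⟨i, by omega⟩) := by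
    intro i
    congr 1
    -- At the tie the slope is the absolute value, but `h` increases there.
    rcases eq_or_ne (i : ℕ) k with hik | hik
    · have h1 : x ⟨i + 1, by omega⟩ - x ⟨i, by omega⟩ = 0 := by simp [x_apply, hik]
      have h2 : h ⟨i + 1, by omega⟩ - h ⟨i, by omega⟩ = 2 := by
        simp [h_apply, hik]; norm_num
      rw [h1, h2, absSlope_zero_left, abs_of_pos two_pos]
    · refine absSlope_of_pos ?_ _
      rw [x_apply, x_apply, sub_pos]
      dsimp only
      split_ifs <;> first | omega | (push_cast; linarith)
  have hvertex : ∀ j : Fin p, κ * absSlope (x j) (h j) = κ * h j := fun j => by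
    rw [absSlope_of_pos (x_pos j)]
  simp only [hedge, hvertex] at this
  rw [sum_mul_sub_eq_sum_sub_mul hp ha_zero ha_last h.ofLp, h_sum fun j => a j - a (j + 1),
    h_sum fun _ => κ, sub_self, add_zero] at this
  change 0 < a (k + 1) - a (k + 2) - (a k - a (k + 1)) at this
  linarith

theorem forall_l1Slope_fusedLassoMatrix_pos_iff (hp : 1 ≤ p) (ha_zero : a 0 = 0)
    (ha_last : a p = 0) (ha : ∀ i, 0 < i → i < p → 0 < a i) (hκ : 0 < κ) :
    (∀ x, ∀ h ∈ (modelSpace (rowForm (fusedLassoMatrix p a κ)) x)ᗮ, h ≠ 0 →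
      0 < l1Slope (rowForm (fusedLassoMatrix p a κ)) x h) ↔
    StrictConcaveSeq p a ∧ ∀ i < p, a i + a (i + 1) < κ :=
  ⟨fun hpos => ⟨strictConcaveSeq_of_second_diff fun _ hk =>
      second_diff_of_l1Slope_pos hp ha_zero ha_last ha hκ hpos hk,
    fun _ hk => add_lt_of_l1Slope_pos hp ha_zero ha_last ha hκ hpos hk⟩,
  fun ⟨hconc, hlt⟩ _ _ hh h0 =>
    l1Slope_fusedLassoMatrix_pos hp ha_zero ha_last ha hκ hconc hlt hh h0⟩

end FusedLasso

/-! ### Pattern recovery by the Fused Lasso -/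

theorem proposition1 {Ω : Type*} [MeasurableSpace Ω] (μ : Measure Ω) [IsProbabilityMeasure μ]
    (p : ℕ) (hp : 1 ≤ p) (a : ℕ → ℝ) (ha_zero : a 0 = 0) (ha_last : a p = 0)
    (ha_pos : ∀ i, 0 < i → i < p → 0 < a i) (κ : ℝ) (hκ : 0 < κ) (σ : ℝ) (hσ : 0 < σ)
    (X : ℕ → Ω → EuclideanSpace ℝ (Fin p)) (ε : ℕ → Ω → ℝ)
    (hmodel : IsDesignAndNoise μ (1 : Matrix (Fin p) (Fin p) ℝ) σ X ε)
    (βhat : EuclideanSpace ℝ (Fin p) → ℝ → ℕ → Ω → EuclideanSpace ℝ (Fin p))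
    (hβhat : ∀ β₀ : EuclideanSpace ℝ (Fin p), ∀ lam : ℝ, 0 < lam → ∀ n : ℕ,
      IsEstimator μ X (response X ε β₀) (fusedLasso p a κ lam) n (βhat β₀ lam n)) :
    ∃ L : EuclideanSpace ℝ (Fin p) → ℝ → ℝ,
      (∀ β₀ : EuclideanSpace ℝ (Fin p), ∀ lam : ℝ, 0 < lam →
        Tendsto (fun n : ℕ => μ.real {ω |
            genLassoPattern (fusedLassoMatrix p a κ) lam (βhat β₀ lam n ω) =
              genLassoPattern (fusedLassoMatrix p a κ) lam β₀})
          atTop (𝓝 (L β₀ lam))) ∧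
      ((∀ β₀ : EuclideanSpace ℝ (Fin p), Tendsto (L β₀) atTop (𝓝 1)) ↔
        StrictConcaveSeq p a ∧ ∀ i < p, a i + a (i + 1) < κ) := by
  refine ⟨fun β₀ lam => (isotropicGaussian p σ).real
    (dualBody (modelSpace (rowForm (fusedLassoMatrix p a κ)) β₀)ᗮ
      (fun v => lam * l1Slope (rowForm (fusedLassoMatrix p a κ)) β₀ v) 0), ?_, ?_⟩
  · intro β₀ lam hlam
    exact hmodel.tendsto_measureReal_genLassoPattern_eq hσ _ hlam β₀ (hβhat β₀ lam hlam)
  · have : (isotropicGaussian p σ).IsOpenPosMeasure :=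
      (absolutelyContinuous_isotropicGaussian p hσ.ne').isOpenPosMeasure
    rw [← forall_l1Slope_fusedLassoMatrix_pos_iff hp ha_zero ha_last ha_pos hκ]
    exact forall_congr' fun β₀ => tendsto_measureReal_dualBody_iff _ (continuous_l1Slope _ β₀)
      fun t v ht => l1Slope_smul _ β₀ v ht
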